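/- **Definitions.** A *contact relation* on a Boolean algebra $A$ (with $0=1$ allowed; complement $a^*$) is a binary relation $\rho$ such that $a\neq 0\Rightarrow a\rho a$; $a\rho b\Rightarrow a\ne 0\ne b$; $a\rho b\Rightarrow b\rho a$; and $a\rho(b\vee c)\iff a\rho b$ or $a\rho c$. Write $a\ll b$ if not $a\rho b^*$. A *complete local contact algebra* (CLCA) is a triple $(A,\rho,\mathbb B)$ with $A$ a complete Boolean algebra, $\rho$ a contact relation on $A$ and $\mathbb B$ a (possibly non-proper) ideal of $A$ such that: if $a\in\mathbb B$ and $a\ll c$ then $a\ll b\ll c$ for some $b\in\mathbb B$; if $a\rho b$ then $a\rho(c\wedge b)$ for some $c\in\mathbb B$; if $a\ne0$ then $0\neq b\ll a$ for some $b\in\mathbb B$. An *LCA-isomorphism* is a Boolean isomorphism preserving and reflecting $\rho$ and membership in $\mathbb B$. A *$\delta$-ideal* of $(A,\rho,\mathbb B)$ is an ideal $I\subseteq\mathbb B$ such that every $a\in I$ satisfies $a\ll b$ for some $b\in I$; the $\delta$-ideals, ordered by inclusion, form a complete lattice $I(A,\rho,\mathbb B)$, and $I_a=\{b\in\mathbb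 B: b\ll a\}$ is a $\delta$-ideal for every $a\in A$. $\mathbf{MDHLC}$ is the category whose objects are the CLCAs and whose morphisms $\varphi:(A,\rho,\mathbb B)\to(B,\eta,\mathbb B')$ are the maps $\varphi:A\to I(B,\eta,\mathbb B')$ (multi-valued maps from $A$ to $B$) such that, for all $a,b\in A$: $\varphi(a\wedge b)=\varphi(a)\wedge\varphi(b)$; $\varphi(a)=\bigvee\{\varphi(b): b\in\mathbb B,\ b\ll a\}$; $\varphi(0)=\{0\}$; $\varphi(a_1\vee a_2)\subseteq\varphi(b_1)\vee\varphi(b_2)$ whenever $a_i,b_i\in\mathbb B$ and $a_i\ll b_i$ for $i=1,2$; and every element of $\mathbb B'$ belongs to $\varphi(a)$ for some $a\in\mathbb B$. Composition is $(\psi\diamond\varphi)(a)=\bigvee\{\psi(b): b\in\varphi(a)\}$, and the identity of $(A,\rho,\mathbb B)$ is $a\mapsto I_a$. For an LCA-isomorphism $e:(A,\rho,\mathbb B)\to(B,\eta,\mathbb B')$ let $\widetilde e$ be the $\mathbf{MDHLC}$-morphism $a\mapsto I_{e(a)}$. $\mathbf{HLC}$ is the category of locally compact Hausdorff spaces and continuous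 maps. $\Delta^t:\mathbf{HLC}\to\mathbf{MDHLC}$ is the contravariant functor sending $X$ to the CLCA $(RC(X),\rho_X,CR(X))$ of regular closed subsets of $X$, with $F\rho_XG\iff F\cap G\ne\emptyset$ and $CR(X)$ the ideal of compact regular closed sets, and sending $f:X\to Y$ to $G\mapsto\{F\in CR(X): F\subseteq f^{-1}(\operatorname{int}G)\}$ for $G\in RC(Y)$. For a CLCA $(A,\rho,\mathbb B)$ put $aC_\rho b\iff a\rho b$ or $a,b\notin\mathbb B$. A *cluster* is a non-empty $\sigma\subseteq A$ such that $a,b\in\sigma\Rightarrow aC_\rho b$; $a\vee b\in\sigma\Rightarrow a\in\sigma$ or $b\in\sigma$; and $a\in\sigma$ whenever $aC_\rho b$ for all $b\in\sigma$. It is *bounded* if $\sigma\cap\mathbb B\neq\emptyset$. The set of all clusters carries the topology with closed base the sets $\{\sigma: a\in\sigma\}$, $a\in A$, and $\Psi^a(A,\rho,\mathbb B)$ is its subspace of bounded clusters. $\Delta^a:\mathbf{MDHLC}\to\mathbf{HLC}$ is the contravariant functor sending $(A,\rho,\mathbb B)$ to $\Psi^a(A,\rho,\mathbb B)$ and $\varphi:(A,\rho,\mathbb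 B)\to(B,\eta,\mathbb B')$ to the map $f_\varphi:\Psi^a(B,\eta,\mathbb B')\to\Psi^a(A,\rho,\mathbb B)$, where $f_\varphi(\sigma')$ is the unique $\sigma\in\Psi^a(A,\rho,\mathbb B)$ with $\sigma\cap\mathbb B=\{a\in\mathbb B:\ \varphi(b)\cap\sigma'\neq\emptyset\text{ for all }b\in A\text{ with }a\ll b\}$. **Proposition.** The identity functor of $\mathbf{MDHLC}$ and the functor $\Delta^t\circ\Delta^a$ are naturally isomorphic. More precisely, for every CLCA $(A,\rho,\mathbb B)$ the map $\lambda^g_A(a)=\{\sigma\in\Psi^a(A,\rho,\mathbb B): a\in\sigma\}$ is an LCA-isomorphism from $(A,\rho,\mathbb B)$ onto $\Delta^t(\Delta^a(A,\rho,\mathbb B))$, and the morphisms $\widetilde{\lambda^g_A}$ are the components of a natural isomorphism $\mathrm{Id}_{\mathbf{MDHLC}}\cong\Delta^t\circ\Delta^a$. -/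

import Mathlib

open CategoryTheory Opposite

universe u

namespace RegionDuality

/-! ### Contact algebras and local contact algebras -/

/-- `C` is a contact relation on the Boolean algebra `A`, i.e. `(A, C)` is a contact algebra. -/
structure IsContact {A : Type u} [BooleanAlgebra A] (C : A → A → Prop) : Prop where
  refl_of_ne_bot : ∀ a, a ≠ ⊥ → C a a
  ne_bot : ∀ a b, C a b → a ≠ ⊥ ∧ b ≠ ⊥
  symm : ∀ a b, C a b → C b a
  sup_iff : ∀ a b c, C a (b ⊔ c) ↔ C a b ∨ C a c

/-- Non-tangential inclusion with respect to a relation `C`: `a` is not in contact with the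
complement of `b`. -/
def NonTangential {A : Type u} [BooleanAlgebra A] (C : A → A → Prop) (a b : A) : Prop :=
  ¬ C a bᶜ

/-- A local contact algebra structure `(A, ρ, 𝔹)` on a Boolean algebra `A`: a contact relation `ρ`
and a (possibly non-proper) ideal `𝔹` of bounded elements, satisfying (BC1), (BC2), (BC3). -/
class LocalContactAlgebra (A : Type u) [BooleanAlgebra A] where
  contact : A → A → Prop
  bounded : Order.Ideal A
  isContact : IsContact contact
  bc1 : ∀ a c, a ∈ bounded → NonTangential contact a c →
    ∃ b ∈ bounded, NonTangential contact a b ∧ NonTangential contact b c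
  bc2 : ∀ a b, contact a b → ∃ c ∈ bounded, contact a (c ⊓ b)
  bc3 : ∀ a, a ≠ ⊥ → ∃ b ∈ bounded, b ≠ ⊥ ∧ NonTangential contact b a

open LocalContactAlgebra (contact bounded)

/-- Non-tangential inclusion in a local contact algebra. -/
def WellInside {A : Type u} [BooleanAlgebra A] [LocalContactAlgebra A] (a b : A) : Prop :=
  NonTangential contact a b

infix:50 " ≪ " => WellInside

section Basic

variable {A : Type u} [BooleanAlgebra A] [LocalContactAlgebra A]

theorem contact_symm {a b : A} (h : contact a b) : contact b a :=
  LocalContactAlgebra.isContact.symm a b h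

theorem contact_sup {a b c : A} : contact a (b ⊔ c) ↔ contact a b ∨ contact a c :=
  LocalContactAlgebra.isContact.sup_iff a b c

theorem contact_mono_right {a b c : A} (hbc : b ≤ c) (h : contact a b) : contact a c := by
  rw [← sup_eq_right.2 hbc]
  exact contact_sup.2 (Or.inl h)

theorem contact_mono {a b c d : A} (hac : a ≤ c) (hbd : b ≤ d) (h : contact a b) :
    contact c d :=
  contact_mono_right hbd (contact_symm (contact_mono_right hac (contact_symm h)))

theorem not_contact_bot (a : A) : ¬ contact a (⊥ : A) := fun h =>
  (LocalContactAlgebra.isContact.ne_bot _ _ h).2 rfl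

theorem WellInside.mono {a b c d : A} (hab : a ≤ b) (h : b ≪ c) (hcd : c ≤ d) : a ≪ d :=
  fun h' => h (contact_mono hab (compl_le_compl hcd) h')

theorem WellInside.compl {a b : A} (h : a ≪ b) : bᶜ ≪ aᶜ := fun h' => by
  rw [compl_compl] at h'
  exact h (contact_symm h')

theorem WellInside.le {a b : A} (h : a ≪ b) : a ≤ b := by
  by_contra hab
  have hne : a ⊓ bᶜ ≠ ⊥ := fun h0 => hab (by
    rw [← sdiff_eq, sdiff_eq_bot_iff] at h0
    exact h0)
  exact h (contact_mono inf_le_left inf_le_right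
    (LocalContactAlgebra.isContact.refl_of_ne_bot _ hne))

theorem WellInside.sup {a b c d : A} (h : a ≪ c) (h' : b ≪ d) : a ⊔ b ≪ c ⊔ d := fun hc => by
  rw [compl_sup] at hc
  rcases contact_sup.1 (contact_symm hc) with h1 | h1
  · exact h (contact_mono le_rfl inf_le_left (contact_symm h1))
  · exact h' (contact_mono le_rfl inf_le_right (contact_symm h1))

theorem WellInside.inf {a b c d : A} (h : a ≪ c) (h' : b ≪ d) : a ⊓ b ≪ c ⊓ d := fun hc => by
  rw [compl_inf] at hc
  rcases contact_sup.1 hc with h1 | h1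
  · exact h (contact_mono inf_le_left le_rfl h1)
  · exact h' (contact_mono inf_le_right le_rfl h1)

theorem bot_wellInside (a : A) : (⊥ : A) ≪ a := fun h => not_contact_bot _ (contact_symm h)

theorem WellInside.interp {a c : A} (ha : a ∈ bounded (A := A)) (h : a ≪ c) :
    ∃ b ∈ bounded (A := A), a ≪ b ∧ b ≪ c :=
  LocalContactAlgebra.bc1 a c ha h

theorem exists_wellInside {a : A} (ha : a ∈ bounded (A := A)) :
    ∃ b ∈ bounded (A := A), a ≪ b := by
  have h : a ≪ ⊤ := fun h => by
    rw [compl_top] at h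
    exact not_contact_bot _ h
  obtain ⟨b, hb, hab, -⟩ := h.interp ha
  exact ⟨b, hb, hab⟩

end Basic

/-! ### δ-ideals -/

/-- A δ-ideal of a local contact algebra `(A, ρ, 𝔹)`: an ideal `I ⊆ 𝔹` such that every element of
`I` is non-tangentially included in another element of `I`. -/
structure DeltaIdeal (A : Type u) [BooleanAlgebra A] [LocalContactAlgebra A] extends
    Order.Ideal A where
  le_bounded : ∀ a ∈ carrier, a ∈ bounded (A := A)
  exists_wellInside : ∀ a ∈ carrier, ∃ b ∈ carrier, a ≪ b

namespace DeltaIdeal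

variable {A : Type u} [BooleanAlgebra A] [LocalContactAlgebra A]

instance : SetLike (DeltaIdeal A) A where
  coe I := I.carrier
  coe_injective I J h := by
    obtain ⟨I, _, _⟩ := I
    obtain ⟨J, _, _⟩ := J
    have : I = J := Order.Ideal.ext h
    subst this
    rfl

instance : PartialOrder (DeltaIdeal A) := .ofSetLike (DeltaIdeal A) A

variable {I J : DeltaIdeal A} {a b : A}

theorem ext (h : ∀ a, a ∈ I ↔ a ∈ J) : I = J := SetLike.ext h

theorem mem_of_le (h : a ≤ b) (hb : b ∈ I) : a ∈ I := I.lower' h hb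

theorem sup_mem (ha : a ∈ I) (hb : b ∈ I) : a ⊔ b ∈ I :=
  Order.Ideal.sup_mem (s := I.toIdeal) ha hb

theorem bot_mem (I : DeltaIdeal A) : (⊥ : A) ∈ I := Order.Ideal.bot_mem I.toIdeal

theorem mem_bounded (ha : a ∈ I) : a ∈ bounded (A := A) := I.le_bounded a ha

theorem exists_mem (ha : a ∈ I) : ∃ b ∈ I, a ≪ b := I.exists_wellInside a ha

/-- Constructor of δ-ideals. -/
def ofSet (S : Set A) (h0 : ⊥ ∈ S) (hle : ∀ a b, a ≤ b → b ∈ S → a ∈ S)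
    (hsup : ∀ a b, a ∈ S → b ∈ S → a ⊔ b ∈ S) (hb : ∀ a ∈ S, a ∈ bounded (A := A))
    (hw : ∀ a ∈ S, ∃ b ∈ S, a ≪ b) : DeltaIdeal A where
  carrier := S
  lower' := fun a b hba ha => hle b a hba ha
  nonempty' := ⟨⊥, h0⟩
  directed' := fun a ha b hb => ⟨a ⊔ b, hsup a b ha hb, le_sup_left, le_sup_right⟩
  le_bounded := hb
  exists_wellInside := hw

/-- The principal δ-ideal `I_a = {b ∈ 𝔹 | b ≪ a}`. -/
def principal (a : A) : DeltaIdeal A :=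
  ofSet {b | b ∈ bounded (A := A) ∧ b ≪ a}
    ⟨Order.Ideal.bot_mem _, bot_wellInside a⟩
    (fun _ _ hxy hy => ⟨Order.Ideal.lower _ hxy hy.1, hy.2.mono hxy le_rfl⟩)
    (fun _ _ hx hy => ⟨Order.Ideal.sup_mem hx.1 hy.1,
      (hx.2.sup hy.2).mono le_rfl (sup_le le_rfl le_rfl)⟩)
    (fun _ hx => hx.1)
    (fun _ hx => by
      obtain ⟨y, hy, hxy, hya⟩ := hx.2.interp hx.1
      exact ⟨y, ⟨hy, hya⟩, hxy⟩)

theorem mem_principal : b ∈ principal a ↔ b ∈ bounded (A := A) ∧ b ≪ a := Iff.rfl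

/-- The join of a set of δ-ideals: the elements below a finite join of members. -/
def join (S : Set (DeltaIdeal A)) : DeltaIdeal A :=
  ofSet {x | ∃ t : Finset A, (∀ y ∈ t, ∃ I ∈ S, y ∈ I) ∧ x ≤ t.sup id}
    ⟨∅, by simp⟩
    (fun _ _ hxy ⟨t, ht, hy⟩ => ⟨t, ht, hxy.trans hy⟩)
    (fun x y ⟨t, ht, hx⟩ ⟨s, hs, hy⟩ => by
      classical
      refine ⟨t ∪ s, fun z hz => ?_, ?_⟩
      · rcases Finset.mem_union.1 hz with h | h
        exacts [ht z h, hs z h]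
      · rw [Finset.sup_union]
        exact sup_le_sup hx hy)
    (fun x ⟨t, ht, hx⟩ => Order.Ideal.lower _ hx
      (Finset.sup_induction (Order.Ideal.bot_mem _)
        (fun _ h _ h' => Order.Ideal.sup_mem h h')
        (fun y hy => by
          obtain ⟨I, -, hI⟩ := ht y hy
          exact mem_bounded hI)))
    (fun x ⟨t, ht, hx⟩ => by
      classical
      have key : ∀ t : Finset A, (∀ y ∈ t, ∃ I ∈ S, y ∈ I) →
          ∃ s : Finset A, (∀ y ∈ s, ∃ I ∈ S, y ∈ I) ∧ t.sup id ≪ s.sup id := by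
        intro t
        induction t using Finset.induction_on with
        | empty => exact fun _ => ⟨∅, by simp, bot_wellInside _⟩
        | insert y t _ ih =>
          intro ht
          obtain ⟨s, hs, hts⟩ := ih (fun z hz => ht z (Finset.mem_insert_of_mem hz))
          obtain ⟨I, hI, hyI⟩ := ht y (Finset.mem_insert_self y t)
          obtain ⟨z, hz, hyz⟩ := exists_mem hyI
          refine ⟨insert z s, fun w hw => ?_, ?_⟩
          · rcases Finset.mem_insert.1 hw with rfl | h
            exacts [⟨I, hI, hz⟩, hs w h]
          · rw [Finset.sup_insert, Finset.sup_insert]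
            exact hyz.sup hts
      obtain ⟨s, hs, hts⟩ := key t ht
      exact ⟨s.sup id, ⟨s, hs, le_rfl⟩, hts.mono hx le_rfl⟩)

theorem isLUB_join (S : Set (DeltaIdeal A)) : IsLUB S (join S) := by
  refine ⟨fun I hI x hx => ⟨{x}, ?_, by simp⟩, fun J hJ x => ?_⟩
  · intro y hy
    rw [Finset.mem_singleton.1 hy]
    exact ⟨I, hI, hx⟩
  · rintro ⟨t, ht, hx⟩
    refine mem_of_le hx (Finset.sup_induction (p := fun y => y ∈ J) (bot_mem J)
      (fun _ h _ h' => sup_mem h h') fun y hy => ?_)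
    obtain ⟨I, hI, hyI⟩ := ht y hy
    exact hJ hI hyI

/-- The meet of two δ-ideals is their intersection. -/
def meet (I J : DeltaIdeal A) : DeltaIdeal A :=
  ofSet {x | x ∈ I ∧ x ∈ J} ⟨bot_mem I, bot_mem J⟩
    (fun _ _ h hb => ⟨mem_of_le h hb.1, mem_of_le h hb.2⟩)
    (fun _ _ ha hb => ⟨sup_mem ha.1 hb.1, sup_mem ha.2 hb.2⟩)
    (fun _ ha => mem_bounded ha.1)
    (fun a ha => by
      obtain ⟨b, hb, hab⟩ := exists_mem ha.1
      obtain ⟨c, hc, hac⟩ := exists_mem ha.2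
      exact ⟨b ⊓ c, ⟨mem_of_le inf_le_left hb, mem_of_le inf_le_right hc⟩,
        (hab.inf hac).mono (le_inf le_rfl le_rfl) le_rfl⟩)

instance : SupSet (DeltaIdeal A) := ⟨join⟩

/-- The lattice of δ-ideals, ordered by inclusion. -/
instance : CompleteLattice (DeltaIdeal A) where
  __ := completeLatticeOfSup (DeltaIdeal A) isLUB_join
  inf := meet
  inf_le_left _ _ _ h := h.1
  inf_le_right _ _ _ h := h.2
  le_inf _ _ _ h h' _ hx := ⟨h hx, h' hx⟩

theorem mem_inf : a ∈ I ⊓ J ↔ a ∈ I ∧ a ∈ J := Iff.rfl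

theorem mem_sSup {S : Set (DeltaIdeal A)} :
    a ∈ sSup S ↔ ∃ t : Finset A, (∀ y ∈ t, ∃ I ∈ S, y ∈ I) ∧ a ≤ t.sup id := Iff.rfl

theorem mem_sSup_of_mem {S : Set (DeltaIdeal A)} (hI : I ∈ S) (ha : a ∈ I) : a ∈ sSup S :=
  le_sSup hI ha

/-- A nonempty directed join of δ-ideals is a union. -/
theorem mem_sSup_image {B : Type u} [BooleanAlgebra B] {f : B → DeltaIdeal A}
    (hf : Monotone f) {S : Set B} (h0 : ⊥ ∈ S)
    (hsup : ∀ x ∈ S, ∀ y ∈ S, x ⊔ y ∈ S) : a ∈ sSup (f '' S) ↔ ∃ b ∈ S, a ∈ f b := by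
  classical
  constructor
  · rintro ⟨t, ht, ha⟩
    suffices h : ∃ b ∈ S, t.sup id ∈ f b by
      obtain ⟨b, hb, h⟩ := h
      exact ⟨b, hb, mem_of_le ha h⟩
    refine Finset.sup_induction (p := fun y => ∃ b ∈ S, y ∈ f b) ⟨⊥, h0, bot_mem _⟩ ?_ ?_
    · rintro x ⟨b, hb, hx⟩ y ⟨c, hc, hy⟩
      exact ⟨b ⊔ c, hsup b hb c hc, sup_mem (hf le_sup_left hx) (hf le_sup_right hy)⟩
    · intro y hy
      obtain ⟨_, ⟨b, hb, rfl⟩, h⟩ := ht y hy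
      exact ⟨b, hb, h⟩
  · rintro ⟨b, hb, h⟩
    exact mem_sSup_of_mem ⟨b, hb, rfl⟩ h

theorem mem_sup : a ∈ I ⊔ J ↔ ∃ x ∈ I, ∃ y ∈ J, a ≤ x ⊔ y := by
  constructor
  · intro h
    let K : DeltaIdeal A := ofSet {a | ∃ x ∈ I, ∃ y ∈ J, a ≤ x ⊔ y}
      ⟨⊥, bot_mem I, ⊥, bot_mem J, bot_le⟩
      (fun _ _ hab ⟨x, hx, y, hy, h⟩ => ⟨x, hx, y, hy, hab.trans h⟩)
      (fun _ _ ⟨x, hx, y, hy, h⟩ ⟨x', hx', y', hy', h'⟩ =>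
        ⟨x ⊔ x', sup_mem hx hx', y ⊔ y', sup_mem hy hy', by
          rw [sup_sup_sup_comm]
          exact sup_le_sup h h'⟩)
      (fun _ ⟨x, hx, y, hy, h⟩ => Order.Ideal.lower _ h
        (Order.Ideal.sup_mem (mem_bounded hx) (mem_bounded hy)))
      (fun _ ⟨x, hx, y, hy, h⟩ => by
        obtain ⟨x', hx', h1⟩ := exists_mem hx
        obtain ⟨y', hy', h2⟩ := exists_mem hy
        exact ⟨x' ⊔ y', ⟨x', hx', y', hy', le_rfl⟩, (h1.sup h2).mono h le_rfl⟩)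
    have hI : I ≤ K := fun x hx => ⟨x, hx, ⊥, bot_mem J, le_sup_left⟩
    have hJ : J ≤ K := fun y hy => ⟨⊥, bot_mem I, y, hy, le_sup_right⟩
    exact sup_le hI hJ h
  · rintro ⟨x, hx, y, hy, h⟩
    exact mem_of_le h (sup_mem ((le_sup_left : I ≤ I ⊔ J) hx) ((le_sup_right : J ≤ I ⊔ J) hy))

end DeltaIdeal

/-! ### The category `MDHLC` -/

/-- The objects of `MDHLC`: complete local contact algebras. -/
structure MDHLC : Type (u + 1) where
  carrier : Type u
  [completeBooleanAlgebra : CompleteBooleanAlgebra carrier]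
  [localContactAlgebra : LocalContactAlgebra carrier]

namespace MDHLC

instance : CoeSort MDHLC.{u} (Type u) := ⟨MDHLC.carrier⟩

attribute [instance] MDHLC.completeBooleanAlgebra MDHLC.localContactAlgebra

/-- The morphisms of `MDHLC`: multi-valued maps `A → B` satisfying (M1)-(M6); by (M1) the values
are δ-ideals of `B`. -/
structure Hom (A B : MDHLC.{u}) where
  toFun : A → DeltaIdeal B
  map_inf : ∀ a b, toFun (a ⊓ b) = toFun a ⊓ toFun b
  map_eq_sSup : ∀ a, toFun a = sSup (toFun '' {b | b ∈ bounded (A := A) ∧ b ≪ a})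
  map_bot : (toFun ⊥ : Set B) = {⊥}
  map_sup_le : ∀ a₁ a₂ b₁ b₂, a₁ ∈ bounded (A := A) → a₂ ∈ bounded (A := A) →
    b₁ ∈ bounded (A := A) → b₂ ∈ bounded (A := A) → a₁ ≪ b₁ → a₂ ≪ b₂ →
    toFun (a₁ ⊔ a₂) ≤ toFun b₁ ⊔ toFun b₂
  exists_mem : ∀ b ∈ bounded (A := B), ∃ a ∈ bounded (A := A), b ∈ toFun a

namespace Hom

variable {A B C D : MDHLC.{u}}

instance : CoeFun (Hom A B) (fun _ => A → DeltaIdeal B) := ⟨Hom.toFun⟩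

theorem ext' {φ ψ : Hom A B} (h : ∀ a b, b ∈ φ a ↔ b ∈ ψ a) : φ = ψ := by
  have : φ.toFun = ψ.toFun := funext fun a => DeltaIdeal.ext (h a)
  cases φ
  cases ψ
  cases this
  rfl

theorem mono (φ : Hom A B) : Monotone φ := fun a b h => by
  have := φ.map_inf a b
  rw [inf_eq_left.2 h] at this
  rw [this]
  exact inf_le_right

theorem mem_bot {φ : Hom A B} {b : B} : b ∈ φ ⊥ ↔ b = ⊥ := by
  have := φ.map_bot
  rw [← SetLike.mem_coe, this, Set.mem_singleton_iff]

theorem mem_iff (φ : Hom A B) {a : A} {x : B} :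
    x ∈ φ a ↔ ∃ b, (b ∈ bounded (A := A) ∧ b ≪ a) ∧ x ∈ φ b := by
  conv_lhs => rw [φ.map_eq_sSup a]
  exact DeltaIdeal.mem_sSup_image (S := {b | b ∈ bounded (A := A) ∧ b ≪ a}) φ.mono
    (DeltaIdeal.bot_mem (DeltaIdeal.principal a))
    (fun _ hx _ hy => DeltaIdeal.sup_mem (I := DeltaIdeal.principal a) hx hy)

/-- Constructor of morphisms with (M2)-(M5) stated through elements. -/
def ofMem (f : A → DeltaIdeal B) (hmono : Monotone f)
    (hinf : ∀ a b x, x ∈ f a → x ∈ f b → x ∈ f (a ⊓ b))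
    (hsup : ∀ a x, x ∈ f a → ∃ b ∈ bounded (A := A), b ≪ a ∧ x ∈ f b)
    (hbot : ∀ x ∈ f ⊥, x = ⊥)
    (hle : ∀ a₁ a₂ b₁ b₂ : A, a₁ ≪ b₁ → a₂ ≪ b₂ → ∀ x ∈ f (a₁ ⊔ a₂),
      ∃ y ∈ f b₁, ∃ z ∈ f b₂, x ≤ y ⊔ z)
    (hex : ∀ b ∈ bounded (A := B), ∃ a ∈ bounded (A := A), b ∈ f a) : Hom A B where
  toFun := f
  map_inf a b := le_antisymm (le_inf (hmono inf_le_left) (hmono inf_le_right))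
    fun x hx => hinf a b x hx.1 hx.2
  map_eq_sSup a := by
    refine le_antisymm (fun x hx => ?_) (sSup_le ?_)
    · obtain ⟨b, hb, hba, hxb⟩ := hsup a x hx
      exact DeltaIdeal.mem_sSup_of_mem ⟨b, ⟨hb, hba⟩, rfl⟩ hxb
    · rintro _ ⟨b, hb, rfl⟩
      exact hmono hb.2.le
  map_bot := Set.Subset.antisymm (fun x hx => hbot x hx)
    (Set.singleton_subset_iff.2 (DeltaIdeal.bot_mem _))
  map_sup_le a₁ a₂ b₁ b₂ _ _ _ _ h₁ h₂ x hx := DeltaIdeal.mem_sup.2 (hle a₁ a₂ b₁ b₂ h₁ h₂ x hx)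
  exists_mem := hex

/-- The identity morphism `a ↦ I_a`. -/
def id (A : MDHLC.{u}) : Hom A A :=
  ofMem DeltaIdeal.principal
    (fun _ _ h _ hx => ⟨hx.1, hx.2.mono le_rfl h⟩)
    (fun _ _ _ hx hy => ⟨hx.1, (hx.2.inf hy.2).mono (le_inf le_rfl le_rfl) le_rfl⟩)
    (fun _ _ hx => by
      obtain ⟨b, hb, h, h'⟩ := hx.2.interp hx.1
      exact ⟨b, hb, h', hx.1, h⟩)
    (fun _ hx => le_bot_iff.1 hx.2.le)
    (fun a₁ a₂ b₁ b₂ h₁ h₂ x hx =>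
      ⟨x ⊓ a₁, ⟨Order.Ideal.lower _ inf_le_left hx.1, h₁.mono inf_le_right le_rfl⟩,
        x ⊓ a₂, ⟨Order.Ideal.lower _ inf_le_left hx.1, h₂.mono inf_le_right le_rfl⟩, by
          rw [← inf_sup_left]
          exact le_inf le_rfl hx.2.le⟩)
    (fun b hb => by
      obtain ⟨a, ha, h⟩ := exists_wellInside hb
      exact ⟨a, ha, hb, h⟩)

theorem mem_id {a b : A} : b ∈ Hom.id A a ↔ b ∈ bounded (A := A) ∧ b ≪ a := Iff.rfl

/-- The underlying multi-valued map `a ↦ ⋁ {ψ(b) | b ∈ φ(a)}` of the composition. -/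
def compFun (φ : Hom A B) (ψ : Hom B C) (a : A) : DeltaIdeal C :=
  sSup (ψ '' {b | b ∈ φ a})

theorem mem_compFun {φ : Hom A B} {ψ : Hom B C} {a : A} {x : C} :
    x ∈ compFun φ ψ a ↔ ∃ b ∈ φ a, x ∈ ψ b :=
  DeltaIdeal.mem_sSup_image (S := {b | b ∈ φ a}) ψ.mono (DeltaIdeal.bot_mem _)
    (fun _ hx _ hy => DeltaIdeal.sup_mem hx hy)

/-- The composition `ψ ⋄ φ`, written in diagrammatic order. -/
def comp (φ : Hom A B) (ψ : Hom B C) : Hom A C where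
  toFun := compFun φ ψ
  map_inf a b := by
    refine DeltaIdeal.ext fun x => ?_
    rw [DeltaIdeal.mem_inf]
    simp only [mem_compFun]
    constructor
    · rintro ⟨y, hy, hx⟩
      exact ⟨⟨y, φ.mono inf_le_left hy, hx⟩, ⟨y, φ.mono inf_le_right hy, hx⟩⟩
    · rintro ⟨⟨y, hy, hx⟩, ⟨z, hz, hx'⟩⟩
      refine ⟨y ⊓ z, ?_, ?_⟩
      · rw [φ.map_inf]
        exact ⟨DeltaIdeal.mem_of_le inf_le_left hy, DeltaIdeal.mem_of_le inf_le_right hz⟩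
      · rw [ψ.map_inf]
        exact ⟨hx, hx'⟩
  map_eq_sSup a := by
    refine le_antisymm (fun x hx => ?_) (sSup_le ?_)
    · obtain ⟨y, hy, hxy⟩ := mem_compFun.1 hx
      obtain ⟨b, hb, hyb⟩ := φ.mem_iff.1 hy
      exact DeltaIdeal.mem_sSup_of_mem ⟨b, hb, rfl⟩ (mem_compFun.2 ⟨y, hyb, hxy⟩)
    · rintro _ ⟨b, hb, rfl⟩ x hx
      obtain ⟨y, hy, hxy⟩ := mem_compFun.1 hx
      exact mem_compFun.2 ⟨y, φ.mono hb.2.le hy, hxy⟩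
  map_bot := by
    refine Set.Subset.antisymm (fun x hx => ?_)
      (Set.singleton_subset_iff.2 (DeltaIdeal.bot_mem _))
    obtain ⟨y, hy, hxy⟩ := mem_compFun.1 hx
    rw [mem_bot.1 hy] at hxy
    exact mem_bot.1 hxy
  map_sup_le a₁ a₂ b₁ b₂ ha₁ ha₂ hb₁ hb₂ h₁ h₂ x hx := by
    obtain ⟨y, hy, hxy⟩ := mem_compFun.1 hx
    obtain ⟨p, hp, q, hq, hle⟩ := DeltaIdeal.mem_sup.1
      (φ.map_sup_le a₁ a₂ b₁ b₂ ha₁ ha₂ hb₁ hb₂ h₁ h₂ hy)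
    obtain ⟨p', hp', hpp⟩ := DeltaIdeal.exists_mem hp
    obtain ⟨q', hq', hqq⟩ := DeltaIdeal.exists_mem hq
    have hx' := ψ.map_sup_le p q p' q' (DeltaIdeal.mem_bounded hp) (DeltaIdeal.mem_bounded hq)
      (DeltaIdeal.mem_bounded hp') (DeltaIdeal.mem_bounded hq') hpp hqq (ψ.mono hle hxy)
    obtain ⟨r, hr, s, hs, hxrs⟩ := DeltaIdeal.mem_sup.1 hx'
    exact DeltaIdeal.mem_sup.2 ⟨r, mem_compFun.2 ⟨p', hp', hr⟩, s, mem_compFun.2 ⟨q', hq', hs⟩, hxrs⟩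
  exists_mem c hc := by
    obtain ⟨b, hb, h⟩ := ψ.exists_mem c hc
    obtain ⟨a, ha, h'⟩ := φ.exists_mem b hb
    exact ⟨a, ha, mem_compFun.2 ⟨b, h', h⟩⟩

theorem mem_comp {φ : Hom A B} {ψ : Hom B C} {a : A} {x : C} :
    x ∈ comp φ ψ a ↔ ∃ b ∈ φ a, x ∈ ψ b := mem_compFun

end Hom

instance : Category MDHLC.{u} where
  Hom := Hom
  id := Hom.id
  comp := Hom.comp
  id_comp φ := Hom.ext' fun _ _ => by
    rw [Hom.mem_comp, φ.mem_iff]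
    rfl
  comp_id φ := Hom.ext' fun a x => by
    rw [Hom.mem_comp]
    constructor
    · rintro ⟨b, hb, hx⟩
      exact DeltaIdeal.mem_of_le hx.2.le hb
    · intro hx
      obtain ⟨y, hy, hxy⟩ := DeltaIdeal.exists_mem hx
      exact ⟨y, hy, DeltaIdeal.mem_bounded hx, hxy⟩
  assoc φ ψ χ := Hom.ext' fun a x => by
    simp only [Hom.mem_comp]
    constructor
    · rintro ⟨c, ⟨b, hb, hc⟩, hx⟩
      exact ⟨b, hb, c, hc, hx⟩
    · rintro ⟨b, hb, c, hc, hx⟩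
      exact ⟨c, ⟨b, hb, hc⟩, hx⟩

end MDHLC

/-! ### LCA-isomorphisms -/

/-- An LCA-isomorphism: a Boolean (equivalently, order) isomorphism that preserves and reflects
contact and boundedness. -/
structure LCAIso (A B : Type u) [BooleanAlgebra A] [BooleanAlgebra B] [LocalContactAlgebra A]
    [LocalContactAlgebra B] where
  toIso : A ≃o B
  contact_iff : ∀ a b, contact (toIso a) (toIso b) ↔ contact a b
  bounded_iff : ∀ a, toIso a ∈ bounded (A := B) ↔ a ∈ bounded (A := A)

namespace LCAIso

variable {A B : MDHLC.{u}}

theorem wellInside_iff (e : LCAIso A B) {a b : A} : e.toIso a ≪ e.toIso b ↔ a ≪ b := by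
  have h := e.contact_iff a bᶜ
  rw [map_compl e.toIso b] at h
  exact not_congr h

/-- The `MDHLC`-morphism `a ↦ I_{e(a)}` induced by an LCA-isomorphism `e`. -/
def tilde (e : LCAIso A B) : A ⟶ B :=
  MDHLC.Hom.ofMem (fun a => DeltaIdeal.principal (e.toIso a))
    (fun _ _ h _ hx => ⟨hx.1, hx.2.mono le_rfl (e.toIso.monotone h)⟩)
    (fun a b x hx hy => ⟨hx.1, by
      rw [map_inf e.toIso]
      exact (hx.2.inf hy.2).mono (le_inf le_rfl le_rfl) le_rfl⟩)
    (fun a x hx => by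
      obtain ⟨y, hy, hxy, hya⟩ := hx.2.interp hx.1
      obtain ⟨c, rfl⟩ := e.toIso.surjective y
      exact ⟨c, (e.bounded_iff c).1 hy, e.wellInside_iff.1 hya, hx.1, hxy⟩)
    (fun x hx => le_bot_iff.1 (by simpa using hx.2.le))
    (fun a₁ a₂ b₁ b₂ h₁ h₂ x hx =>
      ⟨x ⊓ e.toIso a₁, ⟨Order.Ideal.lower _ inf_le_left hx.1,
          (e.wellInside_iff.2 h₁).mono inf_le_right le_rfl⟩,
        x ⊓ e.toIso a₂, ⟨Order.Ideal.lower _ inf_le_left hx.1,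
          (e.wellInside_iff.2 h₂).mono inf_le_right le_rfl⟩, by
          rw [← inf_sup_left, ← map_sup e.toIso]
          exact le_inf le_rfl hx.2.le⟩)
    (fun b hb => by
      obtain ⟨y, hy, h⟩ := exists_wellInside hb
      obtain ⟨a, rfl⟩ := e.toIso.surjective y
      exact ⟨a, (e.bounded_iff a).1 hy, hb, h⟩)

end LCAIso

/-! ### Regular closed sets -/

/-- The regular closed subsets of a topological space. -/
structure RegularClosed (X : Type u) [TopologicalSpace X] where
  carrier : Set X
  closure_interior' : closure (interior carrier) = carrier

namespace RegularClosed

variable {X : Type u} [TopologicalSpace X]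

instance : SetLike (RegularClosed X) X where
  coe F := F.carrier
  coe_injective F G h := by
    cases F
    cases G
    cases h
    rfl

instance : PartialOrder (RegularClosed X) := .ofSetLike (RegularClosed X) X

theorem closure_interior (F : RegularClosed X) : closure (interior (F : Set X)) = F :=
  F.closure_interior'

theorem isClosed (F : RegularClosed X) : IsClosed (F : Set X) := by
  rw [← F.closure_interior]
  exact isClosed_closure

/-- The closure of an open set is regular closed. -/
def ofOpen (U : Set X) (hU : IsOpen U) : RegularClosed X where
  carrier := closure U
  closure_interior' := Set.Subset.antisymm (closure_minimal interior_subset isClosed_closure)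
    (closure_mono (interior_maximal subset_closure hU))

theorem ofOpen_le {U : Set X} {hU : IsOpen U} {F : RegularClosed X} (h : U ⊆ F) :
    ofOpen U hU ≤ F :=
  closure_minimal (s := U) (t := F) h F.isClosed

theorem le_ofOpen {U : Set X} {hU : IsOpen U} {F : RegularClosed X}
    (h : interior (F : Set X) ⊆ U) : F ≤ ofOpen U hU := by
  intro x hx
  have hx' : x ∈ (F : Set X) := hx
  rw [← F.closure_interior] at hx'
  exact closure_mono h hx'

instance : Max (RegularClosed X) where
  max F G :=
    { carrier := (F : Set X) ∪ G
      closure_interior' := Set.Subset.antisymm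
        (closure_minimal interior_subset (F.isClosed.union G.isClosed)) (by
          conv_lhs => rw [← F.closure_interior, ← G.closure_interior, ← closure_union]
          exact closure_mono (Set.union_subset (interior_mono Set.subset_union_left)
            (interior_mono Set.subset_union_right))) }

instance : Min (RegularClosed X) where
  min F G := ofOpen (interior ((F : Set X) ∩ G)) isOpen_interior

instance : Compl (RegularClosed X) where
  compl F := ofOpen (F : Set X)ᶜ F.isClosed.isOpen_compl

instance : Bot (RegularClosed X) where
  bot := { carrier := ∅, closure_interior' := by simp }

instance : Top (RegularClosed X) where
  top := { carrier := Set.univ, closure_interior' := by simp }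

instance : SupSet (RegularClosed X) where
  sSup S :=
    { carrier := closure (⋃ F ∈ S, (F : Set X))
      closure_interior' := Set.Subset.antisymm
        (closure_minimal interior_subset isClosed_closure)
        (closure_minimal (Set.iUnion₂_subset fun F hF => by
          conv_lhs => rw [← F.closure_interior]
          exact closure_mono (interior_mono
            ((Set.subset_biUnion_of_mem (u := fun F : RegularClosed X => (F : Set X)) hF).trans
              subset_closure))) isClosed_closure) }

instance : InfSet (RegularClosed X) where
  sInf S := ofOpen (interior (⋂ F ∈ S, (F : Set X))) isOpen_interior

theorem coe_sup (F G : RegularClosed X) : ((F ⊔ G : RegularClosed X) : Set X) = (F : Set X) ∪ G :=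
  rfl

theorem coe_inf (F G : RegularClosed X) :
    ((F ⊓ G : RegularClosed X) : Set X) = closure (interior ((F : Set X) ∩ G)) := rfl

theorem coe_compl (F : RegularClosed X) : ((Fᶜ : RegularClosed X) : Set X) = closure (F : Set X)ᶜ :=
  rfl

instance : Lattice (RegularClosed X) where
  sup := (· ⊔ ·)
  inf := (· ⊓ ·)
  le_sup_left F G := Set.subset_union_left (s := (F : Set X)) (t := G)
  le_sup_right F G := Set.subset_union_right (s := (F : Set X)) (t := G)
  sup_le F G H h h' := Set.union_subset (s := (F : Set X)) (t := G) (r := H) h h'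
  inf_le_left _ _ := ofOpen_le (interior_subset.trans Set.inter_subset_left)
  inf_le_right _ _ := ofOpen_le (interior_subset.trans Set.inter_subset_right)
  le_inf _ _ _ h h' := le_ofOpen (interior_mono (Set.subset_inter h h'))

/-- The complete Boolean algebra of regular closed sets, with `F ⊔ G = F ∪ G`,
`F ⊓ G = cl (int (F ∩ G))`, and `cl (X \ F)` as the complement of `F`. -/
instance : CompleteBooleanAlgebra (RegularClosed X) where
  le_sup_inf F G H := ofOpen_le (U := interior (((F : Set X) ∪ G) ∩ ((F : Set X) ∪ H))) (by
    intro x hx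
    by_cases hxF : x ∈ (F : Set X)
    · exact Or.inl hxF
    · refine Or.inr (subset_closure ?_)
      refine interior_maximal (t := interior (((F : Set X) ∪ G) ∩ ((F : Set X) ∪ H)) ∩
        (F : Set X)ᶜ) ?_ (isOpen_interior.inter F.isClosed.isOpen_compl) ⟨hx, hxF⟩
      rintro y ⟨hy, hyF⟩
      have hy' := interior_subset hy
      exact ⟨hy'.1.resolve_left hyF, hy'.2.resolve_left hyF⟩)
  inf_compl_le_bot F := ofOpen_le (U := interior ((F : Set X) ∩ closure (F : Set X)ᶜ)) (by
    rw [interior_inter, closure_compl]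
    rintro x ⟨hx, hx'⟩
    exact (interior_subset hx' hx).elim)
  top_le_sup_compl F x _ := by
    by_cases hx : x ∈ (F : Set X)
    · exact Or.inl hx
    · exact Or.inr (subset_closure hx)
  le_top _ _ _ := trivial
  bot_le _ _ h := h.elim
  isLUB_sSup S := ⟨fun F hF => (Set.subset_biUnion_of_mem
      (u := fun F : RegularClosed X => (F : Set X)) hF).trans subset_closure,
    fun G hG => closure_minimal (Set.iUnion₂_subset fun F hF => hG hF) G.isClosed⟩
  isGLB_sInf S := ⟨fun F hF => ofOpen_le (interior_subset.trans (Set.biInter_subset_of_mem hF)),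
    fun G hG => le_ofOpen (interior_mono (Set.subset_iInter₂ fun F hF => hG hF))⟩

theorem ne_bot_iff {F : RegularClosed X} : F ≠ ⊥ ↔ (F : Set X).Nonempty := by
  rw [Set.nonempty_iff_ne_empty]
  exact not_congr (SetLike.coe_set_eq (p := F) (q := ⊥)).symm

/-- The standard contact relation: two regular closed sets are in contact iff they meet. -/
def stdContact (F G : RegularClosed X) : Prop := ((F : Set X) ∩ G).Nonempty

theorem isContact_stdContact : IsContact (stdContact (X := X)) where
  refl_of_ne_bot F hF := by
    obtain ⟨x, hx⟩ := ne_bot_iff.1 hF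
    exact ⟨x, hx, hx⟩
  ne_bot F G := fun ⟨x, hx, hx'⟩ => ⟨ne_bot_iff.2 ⟨x, hx⟩, ne_bot_iff.2 ⟨x, hx'⟩⟩
  symm F G := fun ⟨x, hx, hx'⟩ => ⟨x, hx', hx⟩
  sup_iff F G H := by
    unfold stdContact
    rw [coe_sup, Set.inter_union_distrib_left, Set.union_nonempty]

theorem nonTangential_iff {F G : RegularClosed X} :
    NonTangential stdContact F G ↔ (F : Set X) ⊆ interior (G : Set X) := by
  unfold NonTangential stdContact
  rw [coe_compl, closure_compl, Set.not_nonempty_iff_eq_empty, ← Set.disjoint_iff_inter_eq_empty,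
    Set.disjoint_compl_right_iff_subset]

/-- The ideal of compact regular closed sets. -/
def compacts (X : Type u) [TopologicalSpace X] : Order.Ideal (RegularClosed X) where
  carrier := {F | IsCompact (F : Set X)}
  lower' := fun _ G h hF => IsCompact.of_isClosed_subset hF G.isClosed h
  nonempty' := ⟨⊥, isCompact_empty⟩
  directed' := fun F hF G hG => ⟨F ⊔ G, IsCompact.union hF hG, le_sup_left, le_sup_right⟩

theorem mem_compacts {F : RegularClosed X} : F ∈ compacts X ↔ IsCompact (F : Set X) := Iff.rfl

theorem exists_between [T2Space X] [LocallyCompactSpace X] {K U : Set X} (hK : IsCompact K)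
    (hU : IsOpen U) (h : K ⊆ U) :
    ∃ F : RegularClosed X, F ∈ compacts X ∧ K ⊆ interior (F : Set X) ∧ (F : Set X) ⊆ U := by
  obtain ⟨L, hL, hKL, hLU⟩ := exists_compact_between hK hU h
  have hsub : closure (interior L) ⊆ L := closure_minimal interior_subset hL.isClosed
  exact ⟨ofOpen (interior L) isOpen_interior, hL.of_isClosed_subset isClosed_closure hsub,
    hKL.trans (interior_maximal subset_closure isOpen_interior), hsub.trans hLU⟩

/-- The standard local contact algebra of a locally compact Hausdorff space. -/
instance [T2Space X] [LocallyCompactSpace X] : LocalContactAlgebra (RegularClosed X) where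
  contact := stdContact
  bounded := compacts X
  isContact := isContact_stdContact
  bc1 F H hF h := by
    simp only [nonTangential_iff] at h ⊢
    obtain ⟨G, hG, hFG, hGH⟩ := exists_between hF isOpen_interior h
    exact ⟨G, hG, hFG, hGH⟩
  bc2 F G := by
    rintro ⟨x, hxF, hxG⟩
    obtain ⟨K, hK, hxK, -⟩ := exists_between (isCompact_singleton (x := x)) isOpen_univ
      (Set.subset_univ _)
    refine ⟨K, hK, x, hxF, ?_⟩
    rw [coe_inf, interior_inter]
    have hxG' : x ∈ closure (interior (G : Set X)) := by
      rw [G.closure_interior]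
      exact hxG
    exact isOpen_interior.inter_closure ⟨hxK rfl, hxG'⟩
  bc3 F hF := by
    have hne : (interior (F : Set X)).Nonempty := by
      rw [← closure_nonempty_iff, F.closure_interior]
      exact ne_bot_iff.1 hF
    obtain ⟨x, hx⟩ := hne
    obtain ⟨K, hK, hxK, hKF⟩ := exists_between (isCompact_singleton (x := x)) isOpen_interior
      (Set.singleton_subset_iff.2 hx)
    exact ⟨K, hK, ne_bot_iff.2 ⟨x, interior_subset (hxK rfl)⟩, nonTangential_iff.2 hKF⟩

theorem wellInside_iff [T2Space X] [LocallyCompactSpace X] {F G : RegularClosed X} :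
    F ≪ G ↔ (F : Set X) ⊆ interior (G : Set X) := nonTangential_iff

end RegularClosed

/-! ### The category `HLC` and the functor `Δᵗ` -/

/-- Locally compact Hausdorff spaces. -/
def isHLC : ObjectProperty TopCat.{u} := fun X => T2Space X ∧ LocallyCompactSpace X

/-- The category of locally compact Hausdorff spaces and continuous maps. -/
abbrev HLC : Type (u + 1) := isHLC.{u}.FullSubcategory

namespace HLC

instance (X : HLC.{u}) : T2Space X.obj := X.property.1

instance (X : HLC.{u}) : LocallyCompactSpace X.obj := X.property.2

end HLC

/-- The complete local contact algebra of regular closed subsets of `X`. -/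
abbrev psiT (X : HLC.{u}) : MDHLC.{u} := ⟨RegularClosed X.obj⟩

/-- The δ-ideal `{F ∈ CR(X) | F ⊆ f⁻¹(int G)}`. -/
def phiFun {X Y : HLC.{u}} (f : X ⟶ Y) (G : psiT Y) : DeltaIdeal (psiT X) :=
  DeltaIdeal.ofSet (A := RegularClosed X.obj)
    {F : RegularClosed X.obj | F ∈ RegularClosed.compacts X.obj ∧
      (F : Set X.obj) ⊆ f.hom ⁻¹' interior (G : RegularClosed Y.obj).carrier}
    ⟨isCompact_empty, Set.empty_subset _⟩
    (fun _ _ h hF => ⟨Order.Ideal.lower _ h hF.1, fun _ hx => hF.2 (h hx)⟩)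
    (fun _ _ hF hG => ⟨Order.Ideal.sup_mem hF.1 hG.1, Set.union_subset hF.2 hG.2⟩)
    (fun _ hF => hF.1)
    (fun F hF => by
      obtain ⟨K, hK, hFK, hKU⟩ := RegularClosed.exists_between (RegularClosed.mem_compacts.1 hF.1)
        (isOpen_interior.preimage f.hom.hom.continuous) hF.2
      exact ⟨K, ⟨hK, hKU⟩, RegularClosed.wellInside_iff.2 hFK⟩)

theorem mem_phiFun {X Y : HLC.{u}} {f : X ⟶ Y} {G : RegularClosed Y.obj}
    {F : RegularClosed X.obj} : F ∈ (phiFun f G : DeltaIdeal (RegularClosed X.obj)) ↔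
      IsCompact (F : Set X.obj) ∧ (F : Set X.obj) ⊆ f.hom ⁻¹' interior (G : Set Y.obj) := Iff.rfl

/-- The morphism `φ_f : Ψᵗ(Y) ⟶ Ψᵗ(X)`, `φ_f(G) = {F ∈ CR(X) | F ⊆ f⁻¹(int G)}`. -/
def phi {X Y : HLC.{u}} (f : X ⟶ Y) : psiT Y ⟶ psiT X :=
  MDHLC.Hom.ofMem (phiFun f)
    (fun _ _ h _ hF => ⟨hF.1, hF.2.trans (Set.preimage_mono (interior_mono h))⟩)
    (fun G H F hF hF' => ⟨hF.1, fun x hx => by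
      refine interior_maximal subset_closure isOpen_interior ?_
      rw [interior_inter]
      exact ⟨hF.2 hx, hF'.2 hx⟩⟩)
    (fun G F hF => by
      obtain ⟨K, hK, hFK, hKG⟩ := RegularClosed.exists_between
        ((RegularClosed.mem_compacts.1 hF.1).image f.hom.hom.continuous) isOpen_interior
        (Set.image_subset_iff.2 hF.2)
      exact ⟨K, hK, RegularClosed.wellInside_iff.2 hKG, hF.1, Set.image_subset_iff.1 hFK⟩)
    (fun F hF => by
      refine le_bot_iff.1 (show F ≤ ⊥ from fun x hx => ?_)
      exact interior_subset (s := (∅ : Set Y.obj)) (hF.2 hx))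
    (fun G₁ G₂ H₁ H₂ h₁ h₂ F hF => by
      have h₁' := RegularClosed.wellInside_iff.1 h₁
      have h₂' := RegularClosed.wellInside_iff.1 h₂
      obtain ⟨K₁, K₂, hK₁, hK₂, hKH₁, hKH₂, hK⟩ :=
        (RegularClosed.mem_compacts.1 hF.1).binary_compact_cover
          (isOpen_interior.preimage f.hom.hom.continuous)
          (isOpen_interior.preimage f.hom.hom.continuous)
          (show (F : RegularClosed X.obj).carrier ⊆
              f.hom ⁻¹' interior (H₁ : RegularClosed Y.obj).carrier ∪
              f.hom ⁻¹' interior (H₂ : RegularClosed Y.obj).carrier from fun x hx =>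
            (interior_subset (hF.2 hx)).elim (fun h => Or.inl (h₁' h)) (fun h => Or.inr (h₂' h)))
      obtain ⟨L₁, hL₁, hKL₁, hLU₁⟩ := RegularClosed.exists_between hK₁
        (isOpen_interior.preimage f.hom.hom.continuous) hKH₁
      obtain ⟨L₂, hL₂, hKL₂, hLU₂⟩ := RegularClosed.exists_between hK₂
        (isOpen_interior.preimage f.hom.hom.continuous) hKH₂
      refine ⟨L₁, ⟨hL₁, hLU₁⟩, L₂, ⟨hL₂, hLU₂⟩, ?_⟩
      have : (F : RegularClosed X.obj).carrier ⊆ L₁.carrier ∪ L₂.carrier := by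
        have hK' : (F : RegularClosed X.obj).carrier = K₁ ∪ K₂ := hK
        rw [hK']
        exact Set.union_subset_union (hKL₁.trans interior_subset) (hKL₂.trans interior_subset)
      exact this)
    (fun F hF => by
      obtain ⟨K, hK, hFK, -⟩ := RegularClosed.exists_between
        ((RegularClosed.mem_compacts.1 hF).image f.hom.hom.continuous) isOpen_univ
        (Set.subset_univ _)
      exact ⟨K, hK, hF, Set.image_subset_iff.1 hFK⟩)

/-- The contravariant functor `Δᵗ : HLC ⟶ MDHLC`. -/
def DeltaT : HLC.{u}ᵒᵖ ⥤ MDHLC.{u} where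
  obj X := psiT X.unop
  map f := phi f.unop
  map_id X := MDHLC.Hom.ext' fun G F =>
    and_congr_right fun _ => (RegularClosed.wellInside_iff (F := F) (G := G)).symm
  map_comp {X Y Z} f g := MDHLC.Hom.ext' fun G F => by
    refine Iff.trans ?_ MDHLC.Hom.mem_comp.symm
    constructor
    · intro hF
      obtain ⟨K, hK, hFK, hKG⟩ := RegularClosed.exists_between
        ((RegularClosed.mem_compacts.1 hF.1).image g.unop.hom.hom.continuous)
        (isOpen_interior.preimage f.unop.hom.hom.continuous)
        (Set.image_subset_iff.2 hF.2)
      exact ⟨K, ⟨hK, hKG⟩, hF.1, Set.image_subset_iff.1 hFK⟩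
    · rintro ⟨K, hK, hF⟩
      exact ⟨hF.1, fun x hx => hK.2 (interior_subset (hF.2 hx))⟩

/-! ### Clusters and the functor `Δᵃ` -/

/-- The Alexandroff extension `C_ρ` of the contact relation of a local contact algebra. -/
def alexandroff {A : Type u} [BooleanAlgebra A] [LocalContactAlgebra A] (a b : A) : Prop :=
  contact a b ∨ (a ∉ bounded (A := A) ∧ b ∉ bounded (A := A))

/-- `σ` is a cluster with respect to the relation `C`. -/
structure IsCluster {A : Type u} [BooleanAlgebra A] (C : A → A → Prop) (σ : Set A) : Prop where
  nonempty : σ.Nonempty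
  contact_of_mem : ∀ a b, a ∈ σ → b ∈ σ → C a b
  mem_or_mem : ∀ a b, a ⊔ b ∈ σ → a ∈ σ ∨ b ∈ σ
  mem_of_contact : ∀ a, (∀ b ∈ σ, C a b) → a ∈ σ

/-- The clusters of a local contact algebra `(A, ρ, 𝔹)`, i.e. of the contact algebra `(A, C_ρ)`. -/
def Clust (A : Type u) [BooleanAlgebra A] [LocalContactAlgebra A] : Type u :=
  {σ : Set A // IsCluster alexandroff σ}

/-- The topology on clusters having the sets `λ(a) = {σ | a ∈ σ}` as a base of closed sets. -/
instance (A : Type u) [BooleanAlgebra A] [LocalContactAlgebra A] : TopologicalSpace (Clust A) :=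
  TopologicalSpace.generateFrom (Set.range fun a : A => {σ : Clust A | a ∈ σ.1}ᶜ)

/-- The space `Ψᵃ(A, ρ, 𝔹)` of bounded clusters, as a subspace of the space of clusters. If
`1 ∈ 𝔹` then every cluster is bounded; otherwise the only cluster that is not bounded is `A \ 𝔹`. -/
def BClust (A : Type u) [BooleanAlgebra A] [LocalContactAlgebra A] : Type u :=
  {σ : Clust A // ∃ b ∈ σ.1, b ∈ bounded (A := A)}

instance (A : Type u) [BooleanAlgebra A] [LocalContactAlgebra A] : TopologicalSpace (BClust A) :=
  inferInstanceAs (TopologicalSpace {σ : Clust A // ∃ b ∈ σ.1, b ∈ bounded (A := A)})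

/-- The underlying set of elements of a bounded cluster. -/
def BClust.elems {A : Type u} [BooleanAlgebra A] [LocalContactAlgebra A] (σ : BClust A) : Set A :=
  σ.1.1

section Clusters

variable {A : Type u} [BooleanAlgebra A] [LocalContactAlgebra A]

theorem alexandroff_symm {a b : A} (h : alexandroff a b) : alexandroff b a :=
  h.imp contact_symm And.symm

theorem alexandroff_mono {a b c d : A} (hac : a ≤ c) (hbd : b ≤ d) (h : alexandroff a b) :
    alexandroff c d :=
  h.imp (contact_mono hac hbd) fun h =>
    ⟨fun hc => h.1 (Order.Ideal.lower _ hac hc), fun hd => h.2 (Order.Ideal.lower _ hbd hd)⟩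

theorem alexandroff_sup {a b c : A} (h : alexandroff a (b ⊔ c)) :
    alexandroff a b ∨ alexandroff a c := by
  rcases h with h | ⟨ha, hbc⟩
  · exact (contact_sup.1 h).imp Or.inl Or.inl
  · by_cases hb : b ∈ bounded (A := A)
    · exact Or.inr (Or.inr ⟨ha, fun hc => hbc (Order.Ideal.sup_mem hb hc)⟩)
    · exact Or.inl (Or.inr ⟨ha, hb⟩)

theorem not_alexandroff_of_wellInside {a b : A} (ha : a ∈ bounded (A := A)) (h : a ≪ b) :
    ¬ alexandroff a bᶜ := by
  rintro (h' | h')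
  exacts [h h', h'.1 ha]

/-- The interpolation axiom (C5) of the Alexandroff extension. -/
theorem exists_not_alexandroff {a b : A} (h : ¬ alexandroff a b) :
    ∃ c, ¬ alexandroff a c ∧ ¬ alexandroff b cᶜ := by
  have hab : ¬ contact a b := fun h' => h (Or.inl h')
  by_cases ha : a ∈ bounded (A := A)
  · have hw : a ≪ bᶜ := fun h' => hab (by rwa [compl_compl] at h')
    obtain ⟨c, hc, hac, hcb⟩ := hw.interp ha
    refine ⟨cᶜ, not_alexandroff_of_wellInside ha hac, ?_⟩
    have := not_alexandroff_of_wellInside hc hcb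
    rw [compl_compl] at this ⊢
    exact fun h' => this (alexandroff_symm h')
  · have hb : b ∈ bounded (A := A) := by
      by_contra hb
      exact h (Or.inr ⟨ha, hb⟩)
    have hw : b ≪ aᶜ := fun h' => hab (by
      rw [compl_compl] at h'
      exact contact_symm h')
    obtain ⟨c, hc, hbc, hca⟩ := hw.interp hb
    refine ⟨c, ?_, not_alexandroff_of_wellInside hb hbc⟩
    have := not_alexandroff_of_wellInside hc hca
    rw [compl_compl] at this
    exact fun h' => this (alexandroff_symm h')

variable {σ : Set A}

theorem IsCluster.mono (hσ : IsCluster alexandroff σ) {a b : A} (hab : a ≤ b) (ha : a ∈ σ) :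
    b ∈ σ :=
  hσ.mem_of_contact b fun c hc => alexandroff_mono hab le_rfl (hσ.contact_of_mem a c ha hc)

theorem IsCluster.top_mem (hσ : IsCluster alexandroff σ) : ⊤ ∈ σ := by
  obtain ⟨a, ha⟩ := hσ.nonempty
  exact hσ.mono le_top ha

theorem IsCluster.bot_notMem (hσ : IsCluster alexandroff σ) : ⊥ ∉ σ := fun h => by
  rcases hσ.contact_of_mem _ _ h h with h' | h'
  exacts [not_contact_bot _ h', h'.1 (Order.Ideal.bot_mem _)]

theorem IsCluster.mem_of_compl_notMem (hσ : IsCluster alexandroff σ) {a : A} (h : aᶜ ∉ σ) :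
    a ∈ σ := by
  have := hσ.top_mem
  rw [← sup_compl_eq_top (x := a)] at this
  exact (hσ.mem_or_mem _ _ this).resolve_right h

theorem IsCluster.compl_notMem (hσ : IsCluster alexandroff σ) {a b : A}
    (hb : a ∈ bounded (A := A)) (ha : a ∈ σ) (h : a ≪ b) : bᶜ ∉ σ := fun h' =>
  not_alexandroff_of_wellInside hb h (hσ.contact_of_mem _ _ ha h')

/-- A prime, pairwise contacting family generates a cluster. -/
theorem isCluster_of_clan {p : Set A} (htop : ⊤ ∈ p)
    (hprime : ∀ a b, a ⊔ b ∈ p → a ∈ p ∨ b ∈ p)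
    (hcontact : ∀ a b, a ∈ p → b ∈ p → alexandroff a b) :
    IsCluster alexandroff {a | ∀ b ∈ p, alexandroff a b} where
  nonempty := ⟨⊤, fun b hb => hcontact _ _ htop hb⟩
  contact_of_mem a b ha hb := by
    by_contra h
    obtain ⟨c, hac, hbc⟩ := exists_not_alexandroff h
    rw [← sup_compl_eq_top (x := c)] at htop
    rcases hprime _ _ htop with h' | h'
    exacts [hac (ha c h'), hbc (hb _ h')]
  mem_or_mem a b hab := by
    have key : ∀ a : A, (∃ x ∈ p, ¬ alexandroff a x) → ∃ c, ¬ alexandroff a c ∧ cᶜ ∉ p := by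
      rintro a ⟨x, hx, hax⟩
      obtain ⟨c, hac, hxc⟩ := exists_not_alexandroff hax
      exact ⟨c, hac, fun h => hxc (hcontact _ _ hx h)⟩
    by_contra h
    simp only [Set.mem_ofPred_eq, not_or, not_forall, exists_prop] at h
    obtain ⟨c, hac, hc⟩ := key a h.1
    obtain ⟨d, hbd, hd⟩ := key b h.2
    have hcd : c ⊓ d ∈ p := by
      rw [← sup_compl_eq_top (x := c ⊓ d), compl_inf] at htop
      exact (hprime _ _ htop).resolve_right fun h => (hprime _ _ h).elim hc hd
    rcases alexandroff_sup (alexandroff_symm (hab _ hcd)) with h' | h'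
    · exact hac (alexandroff_mono le_rfl inf_le_left (alexandroff_symm h'))
    · exact hbd (alexandroff_mono le_rfl inf_le_right (alexandroff_symm h'))
  mem_of_contact a ha b hb := ha b fun c hc => hcontact _ _ hb hc

theorem Clust.isOpen_notMem (a : A) : IsOpen {σ : Clust A | a ∉ σ.1} :=
  TopologicalSpace.isOpen_generateFrom_of_mem ⟨a, rfl⟩

instance : T2Space (Clust A) := by
  have key : ∀ σ τ : Clust A, ∀ a, a ∈ σ.1 → a ∉ τ.1 →
      ∃ U V : Set (Clust A), IsOpen U ∧ IsOpen V ∧ σ ∈ U ∧ τ ∈ V ∧ Disjoint U V := by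
    intro σ τ a ha ha'
    have : ∃ b ∈ τ.1, ¬ alexandroff a b := by
      by_contra! h
      exact ha' (τ.2.mem_of_contact a h)
    obtain ⟨b, hb, hab⟩ := this
    obtain ⟨c, hac, hbc⟩ := exists_not_alexandroff hab
    refine ⟨_, _, Clust.isOpen_notMem c, Clust.isOpen_notMem cᶜ,
      fun h => hac (σ.2.contact_of_mem _ _ ha h), fun h => hbc (τ.2.contact_of_mem _ _ hb h), ?_⟩
    rw [Set.disjoint_left]
    exact fun ν h h' => h (ν.2.mem_of_compl_notMem h')
  refine ⟨fun σ τ hne => ?_⟩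
  by_cases h : σ.1 ⊆ τ.1
  · have h' : ¬ τ.1 ⊆ σ.1 := fun h' => hne (Subtype.ext (Set.Subset.antisymm h h'))
    obtain ⟨a, ha, ha'⟩ := Set.not_subset.1 h'
    obtain ⟨U, V, hU, hV, hτ, hσ, hd⟩ := key τ σ a ha ha'
    exact ⟨V, U, hV, hU, hσ, hτ, hd.symm⟩
  · obtain ⟨a, ha, ha'⟩ := Set.not_subset.1 h
    exact key σ τ a ha ha'

instance : CompactSpace (Clust A) := by
  refine ⟨isCompact_iff_ultrafilter_le_nhds.2 fun F _ => ?_⟩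
  let p : Set A := {a | {σ : Clust A | a ∈ σ.1} ∈ F}
  have hp : ∀ a b, a ∈ p → b ∈ p → alexandroff a b := by
    intro a b ha hb
    obtain ⟨σ, h, h'⟩ := F.neBot.nonempty_of_mem (Filter.inter_mem ha hb)
    exact σ.2.contact_of_mem _ _ h h'
  have hc := isCluster_of_clan (p := p)
    (Filter.mem_of_superset Filter.univ_mem fun σ _ => σ.2.top_mem)
    (fun a b h => Ultrafilter.union_mem_iff.1
      (Filter.mem_of_superset h fun σ h => σ.2.mem_or_mem _ _ h)) hp
  let τ : Clust A := ⟨_, hc⟩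
  refine ⟨τ, Set.mem_univ τ, ?_⟩
  rw [TopologicalSpace.nhds_generateFrom]
  refine le_iInf₂ fun U hU => ?_
  obtain ⟨hmem, a, rfl⟩ := hU
  rw [Filter.le_principal_iff]
  exact Ultrafilter.compl_mem_iff_notMem.2 fun ha => hmem fun b hb => hp a b ha hb

instance : T2Space (BClust A) :=
  inferInstanceAs (T2Space {σ : Clust A // ∃ b ∈ σ.1, b ∈ bounded (A := A)})

instance : LocallyCompactSpace (BClust A) := by
  have h : IsOpen {σ : Clust A | ∃ b ∈ σ.1, b ∈ bounded (A := A)} := by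
    refine isOpen_iff_forall_mem_open.2 fun σ ⟨b, hb, hbB⟩ => ?_
    obtain ⟨c, hc, hbc⟩ := exists_wellInside hbB
    exact ⟨_, fun τ hτ => ⟨c, τ.2.mem_of_compl_notMem hτ, hc⟩, Clust.isOpen_notMem cᶜ,
      σ.2.compl_notMem hbB hb hbc⟩
  exact h.locallyCompactSpace

namespace BClust

theorem isCluster (σ : BClust A) : IsCluster alexandroff σ.elems := σ.1.2

theorem ext {σ τ : BClust A} (h : ∀ a, a ∈ σ.elems ↔ a ∈ τ.elems) : σ = τ :=
  Subtype.ext (Subtype.ext (Set.ext h))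

theorem isOpen_notMem (a : A) : IsOpen {σ : BClust A | a ∉ σ.elems} :=
  (Clust.isOpen_notMem a).preimage continuous_subtype_val

theorem exists_bounded_le (σ : BClust A) {a : A} (ha : a ∈ σ.elems) :
    ∃ b ∈ σ.elems, b ∈ bounded (A := A) ∧ b ≤ a := by
  obtain ⟨e, he, heB⟩ := σ.2
  obtain ⟨c, hc, hec⟩ := exists_wellInside heB
  refine ⟨a ⊓ c, ?_, Order.Ideal.lower _ inf_le_right hc, inf_le_left⟩
  have hac : a ⊓ c ⊔ a ⊓ cᶜ ∈ σ.elems := by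
    rw [← inf_sup_left, sup_compl_eq_top, inf_top_eq]
    exact ha
  exact (σ.isCluster.mem_or_mem _ _ hac).resolve_right fun h =>
    σ.isCluster.compl_notMem heB he hec (σ.isCluster.mono inf_le_right h)

/-- A bounded cluster is determined by its bounded elements. -/
theorem eq_of_inter_bounded {σ τ : BClust A}
    (h : ∀ a ∈ bounded (A := A), a ∈ σ.elems ↔ a ∈ τ.elems) : σ = τ := by
  refine ext fun a => ⟨fun ha => ?_, fun ha => ?_⟩
  · obtain ⟨b, hb, hbB, hba⟩ := σ.exists_bounded_le ha
    exact τ.isCluster.mono hba ((h b hbB).1 hb)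
  · obtain ⟨b, hb, hbB, hba⟩ := τ.exists_bounded_le ha
    exact σ.isCluster.mono hba ((h b hbB).2 hb)

theorem inf_mem {I J : DeltaIdeal A} (σ : BClust A) {x y : A} (hx : x ∈ I) (hxσ : x ∈ σ.elems)
    (hy : y ∈ J) (hyσ : y ∈ σ.elems) : ∃ z ∈ I ⊓ J, z ∈ σ.elems := by
  obtain ⟨l, hl, hxl⟩ := DeltaIdeal.exists_mem hx
  obtain ⟨m, hm, hym⟩ := DeltaIdeal.exists_mem hy
  refine ⟨l ⊓ m, ⟨DeltaIdeal.mem_of_le inf_le_left hl, DeltaIdeal.mem_of_le inf_le_right hm⟩,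
    σ.isCluster.mem_of_compl_notMem ?_⟩
  rw [compl_inf]
  exact fun h => (σ.isCluster.mem_or_mem _ _ h).elim
    (σ.isCluster.compl_notMem (DeltaIdeal.mem_bounded hx) hxσ hxl)
    (σ.isCluster.compl_notMem (DeltaIdeal.mem_bounded hy) hyσ hym)

end BClust

end Clusters

section Pullback

variable {A B : MDHLC.{u}}

theorem meets_or_meets (φ : A ⟶ B) (σ : BClust B) {a b : A} (ha : a ∈ bounded (A := A))
    (hab : a ≪ b) : (∃ x ∈ φ.toFun b, x ∈ σ.elems) ∨ (∃ x ∈ φ.toFun aᶜ, x ∈ σ.elems) := by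
  obtain ⟨x, hx, hxB⟩ := σ.2
  obtain ⟨e, he, hxe⟩ := φ.exists_mem x hxB
  obtain ⟨c, hc, hac, hcb⟩ := hab.interp ha
  obtain ⟨d, hd, hcd, hdb⟩ := hcb.interp hc
  have heB : e ⊓ cᶜ ∈ bounded (A := A) := Order.Ideal.lower _ inf_le_left he
  obtain ⟨g, hg, heg, hga⟩ := (hac.compl.mono (inf_le_right (a := e)) le_rfl).interp heB
  have hle : e ≤ c ⊔ e ⊓ cᶜ := by
    rw [sup_inf_left, sup_compl_eq_top, inf_top_eq]
    exact le_sup_right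
  obtain ⟨y, hy, z, hz, hxyz⟩ := DeltaIdeal.mem_sup.1
    (φ.map_sup_le _ _ _ _ hc heB hd hg hcd heg (φ.mono hle hxe))
  rcases σ.isCluster.mem_or_mem _ _ (σ.isCluster.mono hxyz hx) with h | h
  · exact Or.inl ⟨y, φ.mono hdb.le hy, h⟩
  · exact Or.inr ⟨z, φ.mono hga.le hz, h⟩

theorem not_meets_compl (φ : A ⟶ B) (σ : BClust B) {a : A} {x y : B} (hx : x ∈ φ.toFun a)
    (hxσ : x ∈ σ.elems) (hy : y ∈ φ.toFun aᶜ) (hyσ : y ∈ σ.elems) : False := by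
  obtain ⟨z, hz, hzσ⟩ := σ.inf_mem hx hxσ hy hyσ
  rw [← φ.map_inf, inf_compl_eq_bot] at hz
  rw [MDHLC.Hom.mem_bot.1 hz] at hzσ
  exact σ.isCluster.bot_notMem hzσ

theorem isCluster_pullback (φ : A ⟶ B) (σ : BClust B) :
    IsCluster alexandroff {a : A | ∀ x ∈ φ.toFun aᶜ, x ∉ σ.elems} where
  nonempty := ⟨⊤, fun x hx => by
    rw [compl_top] at hx
    rw [MDHLC.Hom.mem_bot.1 hx]
    exact σ.isCluster.bot_notMem⟩
  contact_of_mem := by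
    have key : ∀ a b : A, a ∈ bounded (A := A) → ¬ contact a b →
        (∀ x ∈ φ.toFun aᶜ, x ∉ σ.elems) → (∀ x ∈ φ.toFun bᶜ, x ∉ σ.elems) → False := by
      intro a b haB hab ha hb
      have hw : a ≪ bᶜ := fun h' => hab (by rwa [compl_compl] at h')
      rcases meets_or_meets φ σ haB hw with ⟨x, hx, hxσ⟩ | ⟨x, hx, hxσ⟩
      exacts [hb x hx hxσ, ha x hx hxσ]
    intro a b ha hb
    by_contra h
    have hab : ¬ contact a b := fun h' => h (Or.inl h')
    by_cases haB : a ∈ bounded (A := A)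
    · exact key a b haB hab ha hb
    · by_cases hbB : b ∈ bounded (A := A)
      · exact key b a hbB (fun h' => hab (contact_symm h')) hb ha
      · exact h (Or.inr ⟨haB, hbB⟩)
  mem_or_mem a b hab := by
    by_contra h
    simp only [Set.mem_ofPred_eq, not_or, not_forall, not_not, exists_prop] at h
    obtain ⟨⟨x, hx, hxσ⟩, ⟨y, hy, hyσ⟩⟩ := h
    obtain ⟨z, hz, hzσ⟩ := σ.inf_mem hx hxσ hy hyσ
    rw [← φ.map_inf, ← compl_sup] at hz
    exact hab z hz hzσ
  mem_of_contact a ha x hx hxσ := by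
    obtain ⟨b, ⟨hbB, hba⟩, hxb⟩ := φ.mem_iff.1 hx
    refine not_alexandroff_of_wellInside hbB hba ?_
    rw [compl_compl]
    exact alexandroff_symm (ha b fun y hy hyσ => not_meets_compl φ σ hxb hxσ hy hyσ)

theorem exists_pullback (φ : A ⟶ B) (σ : BClust B) :
    ∃ τ : BClust A, ∀ a, a ∈ τ.elems ↔ ∀ x ∈ φ.toFun aᶜ, x ∉ σ.elems := by
  refine ⟨⟨⟨_, isCluster_pullback φ σ⟩, ?_⟩, fun a => Iff.rfl⟩
  obtain ⟨x, hx, hxB⟩ := σ.2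
  obtain ⟨e, he, hxe⟩ := φ.exists_mem x hxB
  exact ⟨e, fun y hy hyσ => not_meets_compl φ σ hxe hx hy hyσ, he⟩

theorem pullback_aux (φ : A ⟶ B) (σ : BClust B) {a : A} (ha : a ∈ bounded (A := A)) :
    (∀ x ∈ φ.toFun aᶜ, x ∉ σ.elems) ↔
      ∀ b : A, a ≪ b → ((φ.toFun b : Set B) ∩ σ.elems).Nonempty := by
  constructor
  · intro h b hab
    rcases meets_or_meets φ σ ha hab with ⟨x, hx, hxσ⟩ | ⟨x, hx, hxσ⟩
    exacts [⟨x, hx, hxσ⟩, (h x hx hxσ).elim]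
  · intro h x hx hxσ
    obtain ⟨c, ⟨hcB, hca⟩, hxc⟩ := φ.mem_iff.1 hx
    have hac := hca.compl
    rw [compl_compl] at hac
    obtain ⟨y, hy, hyσ⟩ := h _ hac
    exact not_meets_compl φ σ hxc hxσ hy hyσ

/-- For every `MDHLC`-morphism `φ : A ⟶ B` and every `σ' ∈ Ψᵃ(B)` there is exactly one `σ ∈ Ψᵃ(A)`
with `σ ∩ 𝔹 = {a ∈ 𝔹 | ∀ b ∈ A, a ≪ b → φ(b) ∩ σ' ≠ ∅}`. -/
theorem existsUnique_pullback (φ : A ⟶ B) (σ' : BClust B) :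
    ∃! σ : BClust A, σ.elems ∩ {a | a ∈ bounded (A := A)} =
      {a | a ∈ bounded (A := A) ∧
        ∀ b : A, a ≪ b → ((φ.toFun b : Set B) ∩ σ'.elems).Nonempty} := by
  obtain ⟨τ, hτ⟩ := exists_pullback φ σ'
  refine ⟨τ, Set.ext fun a => ⟨fun h => ⟨h.2, ?_⟩, fun h => ⟨?_, h.1⟩⟩, fun ν hν => ?_⟩
  · exact (pullback_aux φ σ' h.2).1 ((hτ a).1 h.1)
  · exact (hτ a).2 ((pullback_aux φ σ' h.1).2 h.2)
  · refine BClust.eq_of_inter_bounded fun a ha => ?_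
    have h := Set.ext_iff.1 hν a
    rw [hτ a, pullback_aux φ σ' ha]
    exact ⟨fun h' => (h.1 ⟨h', ha⟩).2, fun h' => (h.2 ⟨ha, h'⟩).1⟩

/-- The map `f_φ : Ψᵃ(B) → Ψᵃ(A)` of an `MDHLC`-morphism `φ : A ⟶ B`: `f_φ(σ')` is the unique
`σ ∈ Ψᵃ(A)` with `σ ∩ 𝔹 = {a ∈ 𝔹 | ∀ b ∈ A, a ≪ b → φ(b) ∩ σ' ≠ ∅}`. -/
noncomputable def pullback (φ : A ⟶ B) (σ' : BClust B) : BClust A :=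
  (existsUnique_pullback φ σ').choose

theorem mem_pullback {φ : A ⟶ B} {σ' : BClust B} {a : A} :
    a ∈ (pullback φ σ').elems ↔ ∀ x ∈ φ.toFun aᶜ, x ∉ σ'.elems := by
  obtain ⟨τ, hτ⟩ := exists_pullback φ σ'
  have h : pullback φ σ' = τ := by
    have hp := (existsUnique_pullback φ σ').choose_spec.1
    refine BClust.eq_of_inter_bounded fun a ha => ?_
    have h := Set.ext_iff.1 hp a
    rw [hτ a, pullback_aux φ σ' ha]
    exact ⟨fun h' => (h.1 ⟨h', ha⟩).2, fun h' => (h.2 ⟨ha, h'⟩).1⟩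
  rw [h, hτ a]

theorem continuous_pullback (φ : A ⟶ B) : Continuous (pullback φ) := by
  have h1 : Continuous fun σ' : BClust B => (pullback φ σ').1 := by
    refine continuous_generateFrom_iff.2 ?_
    rintro _ ⟨a, rfl⟩
    refine isOpen_iff_forall_mem_open.2 fun σ hσ => ?_
    have hσ' : ¬ a ∈ (pullback φ σ).elems := hσ
    rw [mem_pullback] at hσ'
    push Not at hσ'
    obtain ⟨x, hx, hxσ⟩ := hσ'
    obtain ⟨y, hy, hxy⟩ := DeltaIdeal.exists_mem hx
    refine ⟨_, fun τ hτ => ?_, BClust.isOpen_notMem yᶜ,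
      σ.isCluster.compl_notMem (DeltaIdeal.mem_bounded hx) hxσ hxy⟩
    intro h
    exact mem_pullback.1 h y hy (τ.isCluster.mem_of_compl_notMem hτ)
  exact continuous_induced_rng.2 h1

theorem pullback_id (σ : BClust A) : pullback (𝟙 A) σ = σ := by
  refine BClust.ext fun a => ?_
  rw [mem_pullback]
  constructor
  · intro h
    by_contra ha
    have : ∃ b ∈ σ.elems, ¬ alexandroff a b := by
      by_contra! h'
      exact ha (σ.isCluster.mem_of_contact a h')
    obtain ⟨b, hb, hab⟩ := this
    obtain ⟨c, hc, hcB, hcb⟩ := σ.exists_bounded_le hb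
    refine h c ⟨hcB, fun h' => hab (Or.inl ?_)⟩ hc
    rw [compl_compl] at h'
    exact contact_symm (contact_mono hcb le_rfl h')
  · intro ha x hx hxσ
    have := σ.isCluster.compl_notMem hx.1 hxσ hx.2
    rw [compl_compl] at this
    exact this ha

theorem pullback_comp {C : MDHLC.{u}} (φ : A ⟶ B) (ψ : B ⟶ C) (σ : BClust C) :
    pullback (φ ≫ ψ) σ = pullback φ (pullback ψ σ) := by
  refine BClust.ext fun a => ?_
  rw [mem_pullback, mem_pullback]
  constructor
  · intro h c hc hcσ
    rw [mem_pullback] at hcσ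
    obtain ⟨d, hd, hcd⟩ := DeltaIdeal.exists_mem hc
    rcases meets_or_meets ψ σ (DeltaIdeal.mem_bounded hc) hcd with ⟨x, hx, hxσ⟩ | ⟨x, hx, hxσ⟩
    · exact h x (MDHLC.Hom.mem_comp.2 ⟨d, hd, hx⟩) hxσ
    · exact hcσ x hx hxσ
  · intro h x hx hxσ
    obtain ⟨c, hc, hxc⟩ := MDHLC.Hom.mem_comp.1 hx
    exact h c hc (mem_pullback.2 fun y hy hyσ => not_meets_compl ψ σ hxc hxσ hy hyσ)

end Pullback

/-- The locally compact Hausdorff space `Ψᵃ(A)`. -/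
abbrev psiA (A : MDHLC.{u}) : HLC.{u} :=
  ⟨TopCat.of (BClust A), inferInstanceAs (T2Space (BClust A)),
    inferInstanceAs (LocallyCompactSpace (BClust A))⟩

/-- The contravariant functor `Δᵃ : MDHLC ⟶ HLC`. -/
noncomputable def DeltaA : MDHLC.{u}ᵒᵖ ⥤ HLC.{u} where
  obj A := psiA A.unop
  map φ := ObjectProperty.homMk (TopCat.ofHom ⟨pullback φ.unop, continuous_pullback φ.unop⟩)
  map_id A := by
    refine InducedCategory.hom_ext (TopCat.hom_ext (ContinuousMap.ext fun σ => ?_))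
    exact pullback_id σ
  map_comp φ ψ := by
    refine InducedCategory.hom_ext (TopCat.hom_ext (ContinuousMap.ext fun σ => ?_))
    exact pullback_comp ψ.unop φ.unop σ

/-- The set `λᵍ_A(a) = {σ ∈ Ψᵃ(A) | a ∈ σ}`. -/
def lambdaG (A : MDHLC.{u}) (a : A) : Set (psiA A).obj :=
  {σ : BClust A | a ∈ σ.elems}

end RegionDuality

/-!
Boundedness, contact and order of elements of `A` can be read off from bounded clusters, because two
elements in contact lie in a common bounded cluster, obtained from a pair of prime ideals whose
complements are in contact elementwise. Hence `λᵍ` embeds `A` into the regular closed sets of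
`Ψᵃ(A)`. Its image is dense, and a dense copy of a complete Boolean algebra in a Boolean algebra is
the whole algebra.

For naturality at `φ : A ⟶ B`, both ways around the square send `a` to a family of compact regular
closed sets `F`: those contained in `int λᵍ(b)` for a single `b ∈ φ(a)`, and those contained in
`f_φ⁻¹(int λᵍ(a)) = ⋃ {int λᵍ(b) | b ∈ φ(a)}`. The union is directed, so these families agree by
compactness.
-/

namespace RegionDuality

open LocalContactAlgebra (contact bounded)

theorem surjective_of_dense {A B : Type*} [CompleteBooleanAlgebra A] [BooleanAlgebra B]
    (e : A ↪o B) (hdense : ∀ F : B, F ≠ ⊥ → ∃ a, a ≠ ⊥ ∧ e a ≤ F) : Function.Surjective e := by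
  have eq_bot_of_disjoint {F : B} {c : A} (h : e c ≤ F) (h' : e c ≤ Fᶜ) : c = ⊥ :=
    le_bot_iff.1 (e.le_iff_le.1 ((disjoint_compl_right h h').trans bot_le))
  intro F
  refine ⟨sSup {b | e b ≤ F}, le_antisymm ?_ ?_⟩
  · rw [← disjoint_compl_right_iff, disjoint_iff]
    by_contra hne
    obtain ⟨c, hc, hce⟩ := hdense _ hne
    obtain ⟨hca, hcF⟩ := le_inf_iff.1 hce
    have hcompl : sSup {b | e b ≤ F} ≤ cᶜ := sSup_le fun b hb =>
      le_compl_iff_disjoint_right.2 <| disjoint_iff.2 <| eq_bot_of_disjoint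
        ((e.monotone inf_le_left).trans hb) ((e.monotone inf_le_right).trans hcF)
    exact hc (le_compl_self.1 ((e.le_iff_le.1 hca).trans hcompl))
  · rw [← disjoint_compl_right_iff, disjoint_iff]
    by_contra hne
    obtain ⟨c, hc, hce⟩ := hdense _ hne
    obtain ⟨hcF, hca⟩ := le_inf_iff.1 hce
    exact hc (eq_bot_of_disjoint (e.monotone (le_sSup hcF)) hca)

namespace IsContact

variable {A : Type u} [BooleanAlgebra A] {C : A → A → Prop} {a b c d : A}

theorem mono (hC : IsContact C) (hac : a ≤ c) (hbd : b ≤ d) (h : C a b) : C c d := by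
  rw [← sup_eq_right.2 hac, ← sup_eq_right.2 hbd]
  refine (hC.sup_iff _ _ _).2 (Or.inl (hC.symm _ _ ?_))
  exact (hC.sup_iff _ _ _).2 (Or.inl (hC.symm _ _ h))

theorem of_inf_ne_bot (hC : IsContact C) (h : a ⊓ b ≠ ⊥) : C a b :=
  hC.mono inf_le_left inf_le_right (hC.refl_of_ne_bot _ h)

theorem of_notMem_isPrime (hC : IsContact C) {P : Order.Ideal A} (hP : P.IsPrime) (ha : a ∉ P)
    (hb : b ∉ P) : C a b :=
  hC.of_inf_ne_bot fun h => (hP.mem_or_mem (h ▸ P.bot_mem)).elim ha hb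

/-- The ideal of the elements remote from a filter, that is, not in contact with some member of
it. Prime ideals containing it yield filters in contact with the given one. -/
def remoteIdeal (hC : IsContact C) (F : Order.PFilter A) : Order.Ideal A where
  carrier := {y | ∃ x ∈ F, ¬ C x y}
  lower' := fun _ _ hzy ⟨x, hx, hxy⟩ => ⟨x, hx, fun h => hxy (hC.mono le_rfl hzy h)⟩
  nonempty' := ⟨⊥, ⊤, F.top_mem, fun h => (hC.ne_bot _ _ h).2 rfl⟩
  directed' := fun y ⟨x, hx, hxy⟩ z ⟨w, hw, hwz⟩ =>
    ⟨y ⊔ z, ⟨x ⊓ w, Order.PFilter.inf_mem hx hw, fun h => ((hC.sup_iff _ _ _).1 h).elim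
      (fun h' => hxy (hC.mono inf_le_left le_rfl h'))
      (fun h' => hwz (hC.mono inf_le_right le_rfl h'))⟩, le_sup_left, le_sup_right⟩

theorem exists_isPrime_of_forall_mem (hC : IsContact C) {F : Order.PFilter A}
    (h : ∀ x ∈ F, C x b) :
    ∃ P : Order.Ideal A, P.IsPrime ∧ b ∉ P ∧ ∀ x ∈ F, ∀ y ∉ P, C x y := by
  have hdisj : Disjoint (Order.PFilter.principal b : Set A) (hC.remoteIdeal F : Set A) :=
    Set.disjoint_left.2 fun y hby ⟨x, hx, hxy⟩ =>
      hxy (hC.mono le_rfl (Order.PFilter.mem_principal.1 hby) (h x hx))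
  obtain ⟨P, hP, hFP, hPb⟩ := DistribLattice.prime_ideal_of_disjoint_filter_ideal hdisj
  refine ⟨P, hP, Set.disjoint_left.1 hPb (Order.PFilter.mem_principal.2 le_rfl),
    fun x hx y hy => ?_⟩
  by_contra hxy
  exact hy (hFP ⟨x, hx, hxy⟩)

theorem exists_isPrime_pair (hC : IsContact C) (h : C a b) :
    ∃ P Q : Order.Ideal A, P.IsPrime ∧ Q.IsPrime ∧ a ∉ P ∧ b ∉ Q ∧
      ∀ x ∉ P, ∀ y ∉ Q, C x y := by
  obtain ⟨Q, hQ, hbQ, haQ⟩ := hC.exists_isPrime_of_forall_mem (F := .principal a)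
    fun x hx => hC.mono (Order.PFilter.mem_principal.1 hx) le_rfl h
  obtain ⟨P, hP, haP, hQP⟩ := hC.exists_isPrime_of_forall_mem (F := hQ.compl_filter.toPFilter)
    fun y hy => hC.symm _ _ (haQ a (Order.PFilter.mem_principal.2 le_rfl) y hy)
  exact ⟨P, Q, hP, hQ, haP, hbQ, fun x hx y hy => hC.symm _ _ (hQP y hy x hx)⟩

end IsContact

section ClusterSpace

variable {A : Type u} [BooleanAlgebra A] [LocalContactAlgebra A] {a b : A}

theorem isContact_alexandroff : IsContact (alexandroff (A := A)) where
  refl_of_ne_bot a ha := Or.inl (LocalContactAlgebra.isContact.refl_of_ne_bot a ha)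
  ne_bot a b := by
    rintro (h | ⟨ha, hb⟩)
    · exact LocalContactAlgebra.isContact.ne_bot a b h
    · exact ⟨fun h => ha (h ▸ bounded.bot_mem), fun h => hb (h ▸ bounded.bot_mem)⟩
  symm _ _ := alexandroff_symm
  sup_iff _ _ _ := ⟨alexandroff_sup, fun h => h.elim
    (alexandroff_mono le_rfl le_sup_left) (alexandroff_mono le_rfl le_sup_right)⟩

theorem IsCluster.sup_mem_iff {σ : Set A} (hσ : IsCluster alexandroff σ) :
    a ⊔ b ∈ σ ↔ a ∈ σ ∨ b ∈ σ :=
  ⟨hσ.mem_or_mem a b, fun h => h.elim (hσ.mono le_sup_left) (hσ.mono le_sup_right)⟩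

theorem Clust.exists_mem_mem (h : alexandroff a b) : ∃ σ : Clust A, a ∈ σ.1 ∧ b ∈ σ.1 := by
  obtain ⟨P, Q, hP, hQ, haP, hbQ, hPQ⟩ := isContact_alexandroff.exists_isPrime_pair h
  let p : Set A := {x | x ∉ P ∨ x ∉ Q}
  have contact_of_mem : ∀ x y, x ∈ p → y ∈ p → alexandroff x y := by
    rintro x y (hx | hx) (hy | hy)
    · exact isContact_alexandroff.of_notMem_isPrime hP hx hy
    · exact hPQ x hx y hy
    · exact alexandroff_symm (hPQ y hy x hx)
    · exact isContact_alexandroff.of_notMem_isPrime hQ hx hy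
  have mem_or_mem : ∀ x y, x ⊔ y ∈ p → x ∈ p ∨ y ∈ p := by
    intro x y h
    simp only [p, Set.mem_ofPred_eq, Order.Ideal.sup_mem_iff] at h ⊢
    tauto
  have top_mem : ⊤ ∈ p := Or.inl hP.toIsProper.top_notMem
  exact ⟨⟨_, isCluster_of_clan top_mem mem_or_mem contact_of_mem⟩,
    fun y => contact_of_mem a y (Or.inl haP), fun y => contact_of_mem b y (Or.inr hbQ)⟩

theorem Clust.isTopologicalBasis_notMem :
    TopologicalSpace.IsTopologicalBasis (Set.range fun a : A => {σ : Clust A | a ∉ σ.1}) where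
  exists_subset_inter := by
    rintro _ ⟨a, rfl⟩ _ ⟨b, rfl⟩ σ hσ
    have inter_eq : {σ : Clust A | a ∉ σ.1} ∩ {σ | b ∉ σ.1} = {σ | a ⊔ b ∉ σ.1} :=
      Set.ext fun τ => not_or.symm.trans (not_congr τ.2.sup_mem_iff.symm)
    exact ⟨_, ⟨a ⊔ b, rfl⟩, inter_eq.le hσ, inter_eq.ge⟩
  sUnion_eq := Set.eq_univ_of_forall fun σ => ⟨_, ⟨⊥, rfl⟩, σ.2.bot_notMem⟩
  eq_generateFrom := rfl

namespace BClust

theorem contact_iff_exists_mem_mem :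
    contact a b ↔ ∃ σ : BClust A, a ∈ σ.elems ∧ b ∈ σ.elems := by
  constructor
  · intro h
    obtain ⟨c, hc, hacb⟩ := LocalContactAlgebra.bc2 a b h
    obtain ⟨σ, ha, hcb⟩ := Clust.exists_mem_mem (Or.inl hacb)
    exact ⟨⟨σ, c ⊓ b, hcb, bounded.lower inf_le_left hc⟩, ha, σ.2.mono inf_le_right hcb⟩
  · rintro ⟨σ, ha, hb⟩
    obtain ⟨c, hc, hcB, hca⟩ := σ.exists_bounded_le ha
    rcases σ.isCluster.contact_of_mem c b hc hb with hcb | ⟨hcB', -⟩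
    · exact contact_mono hca le_rfl hcb
    · exact (hcB' hcB).elim

theorem exists_compl_notMem (ha : a ≠ ⊥) : ∃ σ : BClust A, aᶜ ∉ σ.elems := by
  obtain ⟨b, hb, hb0, hba⟩ := LocalContactAlgebra.bc3 a ha
  obtain ⟨σ, hbσ, -⟩ :=
    contact_iff_exists_mem_mem.1 (LocalContactAlgebra.isContact.refl_of_ne_bot b hb0)
  exact ⟨σ, σ.isCluster.compl_notMem hb hbσ hba⟩

theorem le_iff_forall_mem : a ≤ b ↔ ∀ σ : BClust A, a ∈ σ.elems → b ∈ σ.elems := by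
  refine ⟨fun hab σ => σ.isCluster.mono hab, fun h => ?_⟩
  by_contra hab
  have hne : a \ b ≠ ⊥ := fun h => hab (sdiff_eq_bot_iff.1 h)
  obtain ⟨σ, hσ⟩ := exists_compl_notMem hne
  have ha : a ∈ σ.elems := σ.isCluster.mono sdiff_le (σ.isCluster.mem_of_compl_notMem hσ)
  exact hσ (σ.isCluster.mono (le_compl_iff_disjoint_left.2 disjoint_sdiff_self_left) (h σ ha))

theorem exists_notMem_subset {U : Set (BClust A)} (hU : IsOpen U) {σ : BClust A} (hσ : σ ∈ U) :
    ∃ a, a ∉ σ.elems ∧ {τ : BClust A | a ∉ τ.elems} ⊆ U := by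
  obtain ⟨_, ⟨_, ⟨a, rfl⟩, rfl⟩, ha, haU⟩ :=
    (Clust.isTopologicalBasis_notMem.isInducing
      Topology.IsInducing.subtypeVal).exists_subset_of_mem_open hσ hU
  exact ⟨a, ha, haU⟩

theorem isClosed_mem (a : A) : IsClosed {σ : BClust A | a ∈ σ.elems} :=
  ⟨by simpa only [Set.compl_ofPred] using isOpen_notMem a⟩

theorem closure_notMem (a : A) :
    closure {σ : BClust A | a ∉ σ.elems} = {σ : BClust A | aᶜ ∈ σ.elems} := by
  refine Set.Subset.antisymm (closure_minimal (fun σ hσ => ?_) (isClosed_mem aᶜ))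
    fun σ hσ => mem_closure_iff.2 fun U hU hσU => ?_
  · exact σ.isCluster.mem_of_compl_notMem (by rwa [compl_compl])
  · obtain ⟨c, hc, hcU⟩ := exists_notMem_subset hU hσU
    have hne : (a ⊔ c)ᶜ ≠ ⊥ := fun h => hc <| σ.isCluster.mono
      (by rwa [compl_sup, ← sdiff_eq, sdiff_eq_bot_iff] at h) hσ
    obtain ⟨τ, hτ⟩ := exists_compl_notMem hne
    rw [compl_compl, τ.isCluster.sup_mem_iff, not_or] at hτ
    exact ⟨τ, hcU hτ.2, hτ.1⟩

theorem interior_mem (a : A) :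
    interior {σ : BClust A | a ∈ σ.elems} = {σ : BClust A | aᶜ ∉ σ.elems} := by
  rw [interior_eq_compl_closure_compl, Set.compl_ofPred, closure_notMem, Set.compl_ofPred]

end BClust

/-- The map `λᵍ` from a local contact algebra to the regular closed sets of its space of bounded
clusters. -/
def clusterSet (a : A) : RegularClosed (BClust A) where
  carrier := {σ | a ∈ σ.elems}
  closure_interior' := by rw [BClust.interior_mem, BClust.closure_notMem, compl_compl]

theorem mem_interior_clusterSet {σ : BClust A} :
    σ ∈ interior (clusterSet a : Set (BClust A)) ↔ aᶜ ∉ σ.elems :=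
  Set.ext_iff.1 (BClust.interior_mem a) σ

theorem clusterSet_le_clusterSet : clusterSet a ≤ clusterSet b ↔ a ≤ b :=
  BClust.le_iff_forall_mem.symm

theorem exists_clusterSet_le {F : RegularClosed (BClust A)} (hF : F ≠ ⊥) :
    ∃ a : A, a ≠ ⊥ ∧ clusterSet a ≤ F := by
  obtain ⟨σ, hσ⟩ : (interior (F : Set (BClust A))).Nonempty := by
    rw [← closure_nonempty_iff, F.closure_interior]
    exact RegularClosed.ne_bot_iff.1 hF
  obtain ⟨c, hc, hcF⟩ := BClust.exists_notMem_subset isOpen_interior hσ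
  refine ⟨cᶜ, fun h => hc (compl_eq_bot.1 h ▸ σ.isCluster.top_mem), ?_⟩
  have closure_le := closure_minimal (hcF.trans interior_subset) F.isClosed
  rwa [BClust.closure_notMem] at closure_le

end ClusterSpace

section OpenSet

variable {A : Type u} [BooleanAlgebra A] [LocalContactAlgebra A] {a : A} {I : DeltaIdeal A}

/-- The open set of bounded clusters corresponding to a δ-ideal: the clusters meeting it. -/
def DeltaIdeal.openSet (I : DeltaIdeal A) : Set (BClust A) :=
  {σ | ∃ x ∈ I, x ∈ σ.elems}

theorem DeltaIdeal.openSet_eq_iUnion :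
    I.openSet = ⋃ b : I, interior (clusterSet (b : A) : Set (BClust A)) := by
  ext σ
  simp only [Set.mem_iUnion, mem_interior_clusterSet]
  constructor
  · rintro ⟨x, hx, hxσ⟩
    obtain ⟨b, hb, hxb⟩ := exists_mem hx
    exact ⟨⟨b, hb⟩, σ.isCluster.compl_notMem (mem_bounded hx) hxσ hxb⟩
  · rintro ⟨⟨b, hb⟩, hbσ⟩
    exact ⟨b, hb, σ.isCluster.mem_of_compl_notMem hbσ⟩

theorem DeltaIdeal.subset_openSet_iff {K : Set (BClust A)} (hK : IsCompact K) :
    K ⊆ I.openSet ↔ ∃ b ∈ I, K ⊆ interior (clusterSet b : Set (BClust A)) := by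
  rw [openSet_eq_iUnion]
  constructor
  · intro h
    have : Nonempty I := ⟨⟨⊥, bot_mem I⟩⟩
    have directed : Directed (· ⊆ ·) fun b : I => interior (clusterSet (b : A) : Set (BClust A)) :=
      fun b c => ⟨⟨b ⊔ c, sup_mem b.2 c.2⟩, interior_mono (clusterSet_le_clusterSet.2 le_sup_left),
        interior_mono (clusterSet_le_clusterSet.2 le_sup_right)⟩
    obtain ⟨b, hb⟩ := hK.elim_directed_cover _ (fun _ => isOpen_interior) h directed
    exact ⟨b, b.2, hb⟩
  · rintro ⟨b, hb, h⟩
    exact Set.subset_iUnion_of_subset ⟨b, hb⟩ h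

theorem DeltaIdeal.openSet_principal_top :
    (principal (⊤ : A)).openSet = Set.univ := by
  refine Set.eq_univ_of_forall fun σ => ?_
  obtain ⟨b, hbσ, hb⟩ := σ.2
  obtain ⟨c, -, hbc⟩ := RegionDuality.exists_wellInside hb
  exact ⟨b, ⟨hb, hbc.mono le_rfl le_top⟩, hbσ⟩

theorem isCompact_clusterSet_iff :
    IsCompact (clusterSet a : Set (BClust A)) ↔ a ∈ bounded (A := A) := by
  constructor
  · intro h
    obtain ⟨b, hb, hab⟩ := (DeltaIdeal.subset_openSet_iff h).1
      ((Set.subset_univ _).trans DeltaIdeal.openSet_principal_top.ge)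
    exact bounded.lower (clusterSet_le_clusterSet.1 (hab.trans interior_subset)) hb.1
  · intro ha
    have isCompact_mem : IsCompact {σ : Clust A | a ∈ σ.1} :=
      IsClosed.isCompact ⟨Clust.isOpen_notMem a⟩
    have subset_range : {σ : Clust A | a ∈ σ.1} ⊆ Set.range (Subtype.val : BClust A → Clust A) :=
      fun σ hσ => ⟨⟨σ, a, hσ, ha⟩, rfl⟩
    exact (Topology.IsInducing.subtypeVal.isCompact_preimage_iff subset_range).2 isCompact_mem

end OpenSet

/-- The LCA-isomorphism `λᵍ` from a complete local contact algebra to the regular closed sets of its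
space of bounded clusters. -/
noncomputable def lambdaIso (A : MDHLC.{u}) : LCAIso A (psiT (psiA A)) where
  toIso := RelIso.ofSurjective (OrderEmbedding.ofMapLEIff (clusterSet (A := A)) fun _ _ =>
    clusterSet_le_clusterSet) (surjective_of_dense _ fun _ => exists_clusterSet_le)
  contact_iff _ _ := BClust.contact_iff_exists_mem_mem.symm
  bounded_iff _ := isCompact_clusterSet_iff

namespace LCAIso

/-- The inverse of an LCA-isomorphism. -/
def symm {A B : Type u} [BooleanAlgebra A] [BooleanAlgebra B] [LocalContactAlgebra A]
    [LocalContactAlgebra B] (e : LCAIso A B) : LCAIso B A where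
  toIso := e.toIso.symm
  contact_iff a b := by
    rw [← e.contact_iff, OrderIso.apply_symm_apply, OrderIso.apply_symm_apply]
  bounded_iff a := by rw [← e.bounded_iff, OrderIso.apply_symm_apply]

variable {A B C : MDHLC.{u}}

theorem mem_tilde_comp {e : LCAIso A B} {ψ : B ⟶ C} {a : A} {x : C} :
    x ∈ (e.tilde ≫ ψ).toFun a ↔ x ∈ ψ.toFun (e.toIso a) :=
  MDHLC.Hom.mem_comp.trans ψ.mem_iff.symm

theorem tilde_comp_tilde_symm (e : LCAIso A B) : e.tilde ≫ e.symm.tilde = 𝟙 A := by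
  refine MDHLC.Hom.ext' fun a x => mem_tilde_comp.trans ?_
  change x ∈ DeltaIdeal.principal (e.toIso.symm (e.toIso a)) ↔ x ∈ DeltaIdeal.principal a
  rw [OrderIso.symm_apply_apply]

/-- The `MDHLC`-isomorphism `ẽ` induced by an LCA-isomorphism `e`. -/
def tildeIso (e : LCAIso A B) : A ≅ B where
  hom := e.tilde
  inv := e.symm.tilde
  hom_inv_id := e.tilde_comp_tilde_symm
  inv_hom_id := e.symm.tilde_comp_tilde_symm

end LCAIso

section Naturality

variable {A B : MDHLC.{u}}

theorem preimage_pullback_interior_clusterSet (φ : A ⟶ B) (a : A) :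
    pullback φ ⁻¹' interior (clusterSet a : Set (BClust A)) = (φ.toFun a).openSet := by
  ext σ
  rw [Set.mem_preimage, mem_interior_clusterSet, mem_pullback, compl_compl]
  push Not
  rfl

theorem mem_comp_tilde_lambdaIso {φ : A ⟶ B} {a : A} {F : RegularClosed (BClust B)} :
    F ∈ ((φ ≫ (lambdaIso B).tilde).toFun a : DeltaIdeal (RegularClosed (BClust B))) ↔
      IsCompact (F : Set (BClust B)) ∧ (F : Set (BClust B)) ⊆ (φ.toFun a).openSet := by
  have mem_tilde (b : B) : F ∈ ((lambdaIso B).tilde.toFun b : DeltaIdeal (psiT (psiA B))) ↔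
      IsCompact (F : Set (BClust B)) ∧
        (F : Set (BClust B)) ⊆ interior (clusterSet b : Set (BClust B)) :=
    and_congr_right fun _ => RegularClosed.wellInside_iff
  refine MDHLC.Hom.mem_comp.trans ⟨?_, ?_⟩
  · rintro ⟨b, hb, hF⟩
    obtain ⟨hFc, hFb⟩ := (mem_tilde b).1 hF
    exact ⟨hFc, (DeltaIdeal.subset_openSet_iff hFc).2 ⟨b, hb, hFb⟩⟩
  · rintro ⟨hFc, hF⟩
    obtain ⟨b, hb, hFb⟩ := (DeltaIdeal.subset_openSet_iff hFc).1 hF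
    exact ⟨b, hb, (mem_tilde b).2 ⟨hFc, hFb⟩⟩

theorem lambdaIso_naturality (φ : A ⟶ B) :
    φ ≫ (lambdaIso B).tilde =
      (lambdaIso A).tilde ≫ (DeltaA.{u}.rightOp ⋙ DeltaT.{u}).map φ := by
  refine MDHLC.Hom.ext' fun a F => Iff.trans ?_ LCAIso.mem_tilde_comp.symm
  rw [mem_comp_tilde_lambdaIso, ← preimage_pullback_interior_clusterSet]
  exact (mem_phiFun (f := DeltaA.map φ.op) (G := clusterSet a)).symm

end Naturality

end RegionDuality

theorem proposition3p9 :
    ∃ η : 𝟭 RegionDuality.MDHLC.{u} ≅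
        RegionDuality.DeltaA.{u}.rightOp ⋙ RegionDuality.DeltaT.{u},
      ∀ A : RegionDuality.MDHLC.{u},
        ∃ l : RegionDuality.LCAIso A (RegionDuality.psiT (RegionDuality.psiA A)),
          (∀ a : A, (l.toIso a : RegionDuality.RegularClosed (RegionDuality.psiA A).obj).carrier =
            RegionDuality.lambdaG A a) ∧
          η.hom.app A = l.tilde :=
  ⟨NatIso.ofComponents (fun A => (RegionDuality.lambdaIso A).tildeIso)
      fun φ => RegionDuality.lambdaIso_naturality φ,
    fun A => ⟨RegionDuality.lambdaIso A, fun _ => rfl, rfl⟩⟩
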